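/- Let $g$ be a continuous non-negative real function with domain an interval $I=[0,x_0)$, $x_0>0$ (possibly infinite). Say that $g$ is in class $\mathcal B$ if it is geometrically convex, that is $g(\sqrt{xy})\le\sqrt{g(x)g(y)}$ for all $x,y\in I$, and its derivative satisfies $x\,g'(x)\ge g(x)$ for all $x\in I$ where the derivative exists (at $x=0$ the derivative is one-sided). For a matrix $M$ with real non-negative eigenvalues let $\lambda(M)$ denote its eigenvalues, counted with algebraic multiplicity, and for $u,v\in[0,\infty)^n$ write $u\prec_{w(\log)}v$ if, for every $k=1,\dots,n$, the product of the $k$ largest entries of $u$ is at most the product of the $k$ largest entries of $v$. Functions of vectors are taken entrywise; $g(X)$ is given by the functional calculus. Then the following are equivalent: 1. $g$ is in class $\mathcal B$; 2. $g(0)=0$, and $$g^2\big(\sqrt{\lambda(XY)}\big)\prec_{w(\log)}\lambda\big(g(X)g(Y)\big)$$ holds for all $n$ and all positive definite $n\times n$ complex matrices $X$ and $Y$ with spectrum in $I$. In particular, the inequality holds for every $g$ in class $\mathcal B$; and if $g(0)=0$ and the inequality holds for all such $X,Y$, then $g$ is in class $\mathcal B$. -/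

import Mathlib

open scoped ComplexOrder

/-- The interval `[0, x₀)`, where `x₀` may be `∞`. -/
def dom (x₀ : EReal) : Set ℝ := {x | 0 ≤ x ∧ (x : EReal) < x₀}

/-- Geometric convexity on `I`: `g (√(x y)) ≤ √(g x * g y)` for all `x, y ∈ I`. -/
def GeomConvexOn (I : Set ℝ) (g : ℝ → ℝ) : Prop :=
  ∀ x ∈ I, ∀ y ∈ I, g (Real.sqrt (x * y)) ≤ Real.sqrt (g x * g y)

/-- The class `ℬ` on `[0, x₀)`. At each point of the interval where `g`, as a function on that
interval, has a derivative `d`, one has `g x ≤ x * d` (the derivative at `0` is one-sided). -/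
structure ClassB (x₀ : EReal) (g : ℝ → ℝ) : Prop where
  continuousOn : ContinuousOn g (dom x₀)
  nonneg : ∀ x ∈ dom x₀, 0 ≤ g x
  geomConvex : GeomConvexOn (dom x₀) g
  le_mul_deriv : ∀ x ∈ dom x₀, ∀ d : ℝ, HasDerivWithinAt g d (dom x₀) x → g x ≤ x * d

/-- The eigenvalues of a complex square matrix, with algebraic multiplicity, as a multiset of
real numbers. It is used only for products of two positive semidefinite matrices; those have
only real (and non-negative) eigenvalues, so taking real parts loses nothing. -/
noncomputable def eigs {n : ℕ} (M : Matrix (Fin n) (Fin n) ℂ) : Multiset ℝ :=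
  M.charpoly.roots.map Complex.re

/-- Product of the `k` largest elements of `s`. -/
noncomputable def topProd (s : Multiset ℝ) (k : ℕ) : ℝ :=
  ((s.sort (fun a b => b ≤ a)).take k).prod

/-- Log-submajorisation of two multisets of `n` non-negative numbers: for `k = 1, …, n` the
product of the `k` largest elements of `s` is at most that of the `k` largest of `t`. -/
def LogSubmaj (s t : Multiset ℝ) : Prop :=
  s.card = t.card ∧ ∀ k : ℕ, 1 ≤ k → k ≤ s.card → topProd s k ≤ topProd t k

open Matrix Finset

/-! Pass to logarithms: h = log ∘ g ∘ exp. For g of class B that is not zero on the positive points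
of its domain, h is convex with slopes at least 1; thus its inverse is concave with slopes in [0,
1]. If X = U e^α U* and Y = V e^β V*, the eigenvalues of XY are the squared singular values of
e^{α/2} W e^{β/2} with W = U*V; let L(α, β) be the decreasing vector of their logarithms.

The sum of the k largest entries of L is jointly convex in (α, β) (`convexOn_sum_logSing`, from
Weyl's inequality applied to a product of two sandwiches), and each entry is monotone. Interpolate
the inverse of h by a constant plus an average φ of truncations v ↦ min(v, τ). Convexity reduces φ
to its truncations, where monotonicity suffices, so that L(φ∘a, φ∘b)/2 is weakly majorised by φ(L(a,
b)/2) (`sum_logSing_comp_le`). Take a = h∘α, b = h∘β, then apply the convex increasing h and h∘φ ≤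
id: the partial sums of h(L(α, β)/2) are at most those of L(h∘α, h∘β)/2, which is the claim after
exponentiation (`logSubmaj_of_classB`).

Conversely, 1 × 1 matrices give geometric convexity. For the derivative, take 2 × 2 matrices with
eigenvalues ε and x whose top eigenvectors meet at an angle of cosine c. As ε → 0 the inequality
becomes g(xc) ≤ c g(x) (`map_mul_le_of_logSubmaj`), that is, g(x)/x is increasing. -/

/-! ### Ordered eigenvalues and products of the largest ones. -/

/-- Spectral theorem with eigenvalues listed in decreasing order. -/
theorem exists_antitone_diagonalization {n : ℕ} {H : Matrix (Fin n) (Fin n) ℂ}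
    (hH : H.IsHermitian) :
    ∃ d : Fin n → ℝ, Antitone d ∧ ∃ U : Matrix (Fin n) (Fin n) ℂ, Uᴴ * U = 1 ∧
      H = U * diagonal (fun i => (d i : ℂ)) * Uᴴ := by
  let e : Fin n ≃ Fin n := (finCongr (Fintype.card_fin n)).symm.trans
    (Fintype.equivOfCardEq (Fintype.card_fin _))
  let V : Matrix (Fin n) (Fin n) ℂ := hH.eigenvectorUnitary
  have hV : Vᴴ * V = 1 := Unitary.coe_star_mul_self hH.eigenvectorUnitary
  refine ⟨hH.eigenvalues ∘ e, ?_, V.submatrix id e, ?_, ?_⟩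
  · intro i j hij
    simp only [Function.comp, IsHermitian.eigenvalues, e, Equiv.trans_apply,
      Equiv.symm_apply_apply]
    exact hH.eigenvalues₀_antitone (by simpa using hij)
  · rw [conjTranspose_submatrix, submatrix_mul _ _ _ id _ Function.bijective_id |>.symm, hV]
    simp
  · have h := hH.spectral_theorem
    rw [Unitary.conjStarAlgAut_apply] at h
    conv_lhs => rw [h]
    have : diagonal (fun i => ((hH.eigenvalues ∘ e) i : ℂ)) =
        (diagonal ((RCLike.ofReal : ℝ → ℂ) ∘ hH.eigenvalues)).submatrix e e := by
      rw [submatrix_diagonal_equiv]; rfl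
    rw [this, conjTranspose_submatrix, submatrix_mul_equiv, submatrix_mul_equiv]
    rfl

theorem card_eigs {n : ℕ} (M : Matrix (Fin n) (Fin n) ℂ) : (eigs M).card = n := by
  rw [eigs, Multiset.card_map, IsAlgClosed.card_roots_eq_natDegree, M.charpoly_natDegree_eq_dim,
    Fintype.card_fin]

theorem eigs_mul_comm {n : ℕ} (M N : Matrix (Fin n) (Fin n) ℂ) : eigs (M * N) = eigs (N * M) := by
  rw [eigs, eigs, charpoly_mul_comm]

theorem eigs_of_similar {n : ℕ} {M S T : Matrix (Fin n) (Fin n) ℂ} {d : Fin n → ℝ}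
    (hTS : T * S = 1) (hM : M = S * diagonal (fun i => (d i : ℂ)) * T) :
    eigs M = univ.val.map d := by
  rw [hM, eigs_mul_comm, ← mul_assoc, hTS, one_mul, eigs, charpoly_diagonal,
    Polynomial.roots_prod]
  · simp [Function.comp_def]
  · simp [Finset.prod_ne_zero_iff, Polynomial.X_sub_C_ne_zero]

theorem sort_map_univ {n : ℕ} {d : Fin n → ℝ} (hd : Antitone d) :
    (univ.val.map d).sort (fun a b => b ≤ a) = List.ofFn d := by
  rw [Fin.univ_val_map, Multiset.coe_sort]
  apply List.mergeSort_of_pairwise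
  simp_rw [decide_eq_true_eq]
  exact List.sortedGE_iff_pairwise.1 hd.sortedGE_ofFn

theorem topProd_map {n k : ℕ} (hk : k ≤ n) {d : Fin n → ℝ} (hd : Antitone d) :
    topProd (univ.val.map d) k = ∏ i : Fin k, d (Fin.castLE hk i) := by
  rw [topProd, sort_map_univ hd, ← Fin.ofFn_take_eq_take_ofFn hk, List.prod_ofFn]
  rfl

/-! ### Gram determinants and Weyl's product inequality. -/

/-- Cauchy–Binet, as a sum over all maps instead of over `k`-subsets. -/
theorem factorial_mul_det_mul {n k : ℕ} (A : Matrix (Fin k) (Fin n) ℂ)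
    (B : Matrix (Fin n) (Fin k) ℂ) :
    (k.factorial : ℂ) * (A * B).det =
      ∑ p : Fin k → Fin n, (A.submatrix id p).det * (B.submatrix p id).det := by
  have h1 : (A * B).det = ∑ p : Fin k → Fin n, (∏ i, A i (p i)) * (B.submatrix p id).det := by
    have : (A * B) = fun i => ∑ l, A i l • B l := by
      ext i j
      simp [mul_apply, Finset.sum_apply]
    rw [this]
    have h := (detRowAlternating (n := Fin k) (R := ℂ)).toMultilinearMap.map_sum
      (fun i l => A i l • B l)
    refine h.trans (Finset.sum_congr rfl fun p _ => ?_)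
    rw [MultilinearMap.map_smul_univ]
    rfl
  -- Reindexing the maps p by σ costs only the sign from permuting the rows of the second minor.
  -- Summing over all σ then builds the first minor and the factor k!.
  have h2 : ∀ σ : Equiv.Perm (Fin k), (A * B).det = ∑ p : Fin k → Fin n,
      ((Equiv.Perm.sign σ : ℤ) : ℂ) * (∏ i, A i (p (σ i))) * (B.submatrix p id).det := by
    intro σ
    rw [h1, ← Equiv.sum_comp (Equiv.arrowCongr σ.symm (Equiv.refl (Fin n)))]
    refine Finset.sum_congr rfl fun p _ => ?_
    have : B.submatrix (p ∘ σ) id = (B.submatrix p id).submatrix σ id := rfl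
    have h3 : (Equiv.arrowCongr σ.symm (Equiv.refl (Fin n))) p = p ∘ σ := rfl
    rw [h3, this, det_permute]
    simp only [Function.comp]
    ring
  have h4 : (k.factorial : ℂ) * (A * B).det = ∑ _σ : Equiv.Perm (Fin k), (A * B).det := by
    simp [Fintype.card_perm]
  rw [h4, Finset.sum_congr rfl fun σ _ => h2 σ, Finset.sum_comm]
  refine Finset.sum_congr rfl fun p _ => ?_
  rw [← Finset.sum_mul, ← det_transpose (A.submatrix id p), det_apply' (A.submatrix id p)ᵀ]
  rfl

/-- The weights |det|² are non-negative and do not involve d, so two such determinants with the same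
V can be compared term by term. -/
theorem factorial_mul_det_diagonal {n k : ℕ} (d : Fin n → ℝ) (V : Matrix (Fin n) (Fin k) ℂ) :
    (k.factorial : ℝ) * (Vᴴ * diagonal (fun i => (d i : ℂ)) * V).det.re =
      ∑ p : Fin k → Fin n, (∏ i, d (p i)) * Complex.normSq (V.submatrix p id).det := by
  have h := congrArg Complex.re
    (factorial_mul_det_mul (Vᴴ * diagonal (fun i => (d i : ℂ))) V)
  rw [← Complex.ofReal_natCast, Complex.re_ofReal_mul, Complex.re_sum] at h
  rw [h]
  refine Finset.sum_congr rfl fun p _ => ?_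
  have h1 : (Vᴴ * diagonal (fun i => (d i : ℂ))).submatrix id p =
      (V.submatrix p id)ᴴ * diagonal (fun i => (d (p i) : ℂ)) := by
    ext i j
    simp [mul_diagonal]
  rw [h1, det_mul, det_conjTranspose, det_diagonal, ← Complex.ofReal_prod, mul_right_comm,
    Complex.star_def, ← Complex.normSq_eq_conj_mul_self, ← Complex.ofReal_mul, Complex.ofReal_re,
    mul_comm]

/-- `M` increases the Gram determinant of `k` vectors at most by the factor `c`. -/
def GramBound (k : ℕ) {n : ℕ} (M : Matrix (Fin n) (Fin n) ℂ) (c : ℝ) : Prop :=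
  ∀ V : Matrix (Fin n) (Fin k) ℂ, ((M * V)ᴴ * (M * V)).det.re ≤ c * (Vᴴ * V).det.re

theorem GramBound.mul {k n : ℕ} {M N : Matrix (Fin n) (Fin n) ℂ} {c d : ℝ} (hc : 0 ≤ c)
    (hM : GramBound k M c) (hN : GramBound k N d) : GramBound k (M * N) (c * d) := by
  intro V
  have h1 := hM (N * V)
  have h2 := mul_le_mul_of_nonneg_left (hN V) hc
  rw [← Matrix.mul_assoc M N V] at h1
  linarith

theorem Fin.le_of_strictMono {k n : ℕ} {f : Fin k → Fin n} (hf : StrictMono f) (i : Fin k) :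
    i.val ≤ (f i).val := by
  obtain ⟨i, hi⟩ := i
  induction i with
  | zero => simp
  | succ j ih =>
    have h1 := ih (by omega)
    have h2 : f ⟨j, by omega⟩ < f ⟨j + 1, hi⟩ := hf (by simp)
    have h3 : (f ⟨j, by omega⟩).val < (f ⟨j + 1, hi⟩).val := h2
    simp only at h1 ⊢
    omega

/-- In increasing order, the element of index i in the image of p is at least i, and d is
decreasing. -/
theorem prod_injective_le_prod_castLE {n k : ℕ} (hk : k ≤ n) {d : Fin n → ℝ} (hd : Antitone d)
    (h0 : ∀ i, 0 ≤ d i) {p : Fin k → Fin n} (hp : Function.Injective p) :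
    ∏ i, d (p i) ≤ ∏ i : Fin k, d (Fin.castLE hk i) := by
  have hs : (univ.image p).card = k := by
    rw [card_image_of_injective _ hp, card_univ, Fintype.card_fin]
  have h1 : ∏ i, d (p i) = ∏ i : Fin k, d ((univ.image p).orderEmbOfFin hs i) := by
    rw [← Finset.prod_image (f := d) (g := p) (s := univ) hp.injOn]
    conv_lhs => rw [← Finset.image_orderEmbOfFin_univ (univ.image p) hs]
    rw [Finset.prod_image ((univ.image p).orderEmbOfFin hs).injective.injOn]
  rw [h1]
  refine Finset.prod_le_prod (fun i _ => h0 _) fun i _ => hd ?_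
  exact Fin.le_of_strictMono ((univ.image p).orderEmbOfFin hs).strictMono i

theorem gramBound_of_diagonalization {n k : ℕ} (hk : k ≤ n) {M U : Matrix (Fin n) (Fin n) ℂ}
    {d : Fin n → ℝ} (hd : Antitone d) (h0 : ∀ i, 0 ≤ d i) (hU : Uᴴ * U = 1)
    (hM : Mᴴ * M = U * diagonal (fun i => (d i : ℂ)) * Uᴴ) :
    GramBound k M (∏ i : Fin k, d (Fin.castLE hk i)) := by
  intro V
  have hU' : U * Uᴴ = 1 := mul_eq_one_comm.1 hU
  have h1 : (M * V)ᴴ * (M * V) = (Uᴴ * V)ᴴ * diagonal (fun i => (d i : ℂ)) * (Uᴴ * V) := by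
    simp only [conjTranspose_mul, conjTranspose_conjTranspose, Matrix.mul_assoc]
    rw [← Matrix.mul_assoc Mᴴ, hM]
    simp only [Matrix.mul_assoc]
  have h2 : Vᴴ * V = (Uᴴ * V)ᴴ * diagonal (fun _ : Fin n => ((1 : ℝ) : ℂ)) * (Uᴴ * V) := by
    simp only [conjTranspose_mul, conjTranspose_conjTranspose, Complex.ofReal_one,
      diagonal_one, Matrix.mul_one]
    rw [Matrix.mul_assoc, ← Matrix.mul_assoc U, hU', Matrix.one_mul]
  rw [h1, h2]
  have hk0 : (0 : ℝ) < k.factorial := by positivity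
  refine le_of_mul_le_mul_left ?_ hk0
  rw [mul_left_comm, factorial_mul_det_diagonal, factorial_mul_det_diagonal, Finset.mul_sum]
  refine Finset.sum_le_sum fun p _ => ?_
  by_cases hp : Function.Injective p
  · simp only [prod_const_one, one_mul]
    exact mul_le_mul_of_nonneg_right (prod_injective_le_prod_castLE hk hd h0 hp)
      (Complex.normSq_nonneg _)
  · obtain ⟨i, j, hij, hne⟩ : ∃ i j, p i = p j ∧ i ≠ j := by
      simpa [Function.Injective] using hp
    rw [det_zero_of_row_eq hne (by ext l; simp [hij])]
    simp

/-- Weyl's inequality between eigenvalues and Gram determinants. -/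
theorem GramBound.prod_eigenvalues_sq_le {n k : ℕ} (hk : k ≤ n)
    {M S T : Matrix (Fin n) (Fin n) ℂ} {d : Fin n → ℝ} {c : ℝ} (hM : GramBound k M c)
    (hTS : T * S = 1) (hd : M = S * diagonal (fun i => (d i : ℂ)) * T) :
    (∏ i : Fin k, d (Fin.castLE hk i)) ^ 2 ≤ c := by
  -- The first k columns of S are eigenvectors: M acts on their span as D, so their positive Gram
  -- determinant is multiplied by exactly (det D)².
  let V : Matrix (Fin n) (Fin k) ℂ := S.submatrix id (Fin.castLE hk)
  let D : Matrix (Fin k) (Fin k) ℂ := diagonal fun i => (d (Fin.castLE hk i) : ℂ)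
  have h1 : M * V = V * D := by
    have : M * S = S * diagonal (fun i => (d i : ℂ)) := by rw [hd, mul_assoc, hTS, mul_one]
    have h2 := congrArg (fun Z => Z.submatrix id (Fin.castLE hk)) this
    ext i j
    have h3 := congrFun (congrFun h2 i) j
    simp only [submatrix_apply, id, mul_diagonal] at h3
    simp only [V, D, mul_diagonal, submatrix_apply, id]
    rw [← h3]
    simp [mul_apply]
  have hpos : 0 < (Vᴴ * V).det.re := by
    have hinj : Function.Injective V.mulVec := by
      intro x y hxy
      have h4 : (T.submatrix (Fin.castLE hk) id) * V = 1 := by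
        have : (T * S).submatrix (Fin.castLE hk) (Fin.castLE hk) = 1 := by
          rw [hTS]
          exact submatrix_one _ (Fin.castLE_injective hk)
        rw [← this]
        ext i j
        simp [V, mul_apply]
      have h5 := congrArg (fun v => (T.submatrix (Fin.castLE hk) id).mulVec v) hxy
      simpa [mulVec_mulVec, h4] using h5
    exact (Complex.lt_def.1 (PosDef.conjTranspose_mul_self V hinj).det_pos).1
  have h6 := hM V
  rw [h1, conjTranspose_mul, Matrix.mul_assoc, ← Matrix.mul_assoc Vᴴ, det_mul, det_mul,
    mul_comm (Vᴴ * V).det, ← mul_assoc] at h6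
  have h7 : Dᴴ.det * D.det = (((∏ i : Fin k, d (Fin.castLE hk i)) ^ 2 : ℝ) : ℂ) := by
    simp only [D, det_conjTranspose, det_diagonal]
    rw [← Complex.ofReal_prod, Complex.star_def, Complex.conj_ofReal]
    push_cast
    ring
  rw [h7, Complex.re_ofReal_mul] at h6
  exact le_of_mul_le_mul_right h6 hpos

/-! ### Singular values and their monotonicity. -/

theorem Antitone.eq_of_map_univ_eq {n : ℕ} {d e : Fin n → ℝ} (hd : Antitone d) (he : Antitone e)
    (h : univ.val.map d = univ.val.map e) : d = e := by
  rw [← List.ofFn_inj, ← sort_map_univ hd, ← sort_map_univ he, h]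

/-- The squared singular values of `M` in decreasing order. -/
noncomputable def sqSing {n : ℕ} (M : Matrix (Fin n) (Fin n) ℂ) : Fin n → ℝ :=
  (exists_antitone_diagonalization (isHermitian_conjTranspose_mul_self M)).choose

section sqSing

variable {n : ℕ} (M N : Matrix (Fin n) (Fin n) ℂ)

theorem sqSing_antitone : Antitone (sqSing M) :=
  (exists_antitone_diagonalization (isHermitian_conjTranspose_mul_self M)).choose_spec.1

theorem exists_diagonalization_sqSing : ∃ U : Matrix (Fin n) (Fin n) ℂ, Uᴴ * U = 1 ∧
    Mᴴ * M = U * diagonal (fun i => (sqSing M i : ℂ)) * Uᴴ :=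
  (exists_antitone_diagonalization (isHermitian_conjTranspose_mul_self M)).choose_spec.2

theorem diagonal_sqSing_eq {U : Matrix (Fin n) (Fin n) ℂ} (hU : Uᴴ * U = 1)
    (h : Mᴴ * M = U * diagonal (fun i => (sqSing M i : ℂ)) * Uᴴ) :
    (M * U)ᴴ * (M * U) = diagonal (fun i => (sqSing M i : ℂ)) := by
  rw [conjTranspose_mul, mul_assoc, ← mul_assoc Mᴴ, h]
  simp only [mul_assoc]
  rw [hU, mul_one, ← mul_assoc, hU, one_mul]

theorem sqSing_nonneg (i : Fin n) : 0 ≤ sqSing M i := by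
  obtain ⟨U, hU, h⟩ := exists_diagonalization_sqSing M
  have h1 := (posSemidef_conjTranspose_mul_self (M * U)).diag_nonneg (i := i)
  rw [diagonal_sqSing_eq M hU h, diagonal_apply_eq] at h1
  exact_mod_cast h1

theorem sqSing_pos {T : Matrix (Fin n) (Fin n) ℂ} (hT : T * M = 1) (i : Fin n) :
    0 < sqSing M i := by
  obtain ⟨U, hU, h⟩ := exists_diagonalization_sqSing M
  have hinj : Function.Injective (M * U).mulVec := by
    intro x y hxy
    have h5 := congrArg (fun v => (Uᴴ * T).mulVec v) hxy
    have h6 : Uᴴ * T * (M * U) = 1 := by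
      rw [mul_assoc, ← mul_assoc T, hT, one_mul, hU]
    simpa [mulVec_mulVec, h6] using h5
  have h1 := (PosDef.conjTranspose_mul_self (M * U) hinj).diag_pos (i := i)
  rw [diagonal_sqSing_eq M hU h, diagonal_apply_eq] at h1
  exact_mod_cast h1

theorem eigs_conjTranspose_mul_self : eigs (Mᴴ * M) = univ.val.map (sqSing M) := by
  obtain ⟨U, hU, h⟩ := exists_diagonalization_sqSing M
  exact eigs_of_similar hU h

theorem sqSing_conjTranspose : sqSing Mᴴ = sqSing M := by
  refine (sqSing_antitone _).eq_of_map_univ_eq (sqSing_antitone _) ?_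
  rw [← eigs_conjTranspose_mul_self, ← eigs_conjTranspose_mul_self, eigs_mul_comm,
    conjTranspose_conjTranspose]

variable {k : ℕ} (hk : k ≤ n)

theorem gramBound_prod_sqSing : GramBound k M (∏ i : Fin k, sqSing M (Fin.castLE hk i)) := by
  obtain ⟨U, hU, h⟩ := exists_diagonalization_sqSing M
  exact gramBound_of_diagonalization hk (sqSing_antitone M) (sqSing_nonneg M) hU h

variable {M} in
theorem GramBound.prod_sqSing_le {c : ℝ} (hc : GramBound k M c) :
    ∏ i : Fin k, sqSing M (Fin.castLE hk i) ≤ c := by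
  obtain ⟨U, hU, h⟩ := exists_diagonalization_sqSing M
  have h1 := hc (U.submatrix id (Fin.castLE hk))
  have h2 : (M * U.submatrix id (Fin.castLE hk))ᴴ * (M * U.submatrix id (Fin.castLE hk)) =
      diagonal fun i => (sqSing M (Fin.castLE hk i) : ℂ) := by
    have : M * U.submatrix id (Fin.castLE hk) = (M * U).submatrix id (Fin.castLE hk) := by
      ext i j
      simp [mul_apply]
    rw [this, conjTranspose_submatrix, ← submatrix_mul _ _ _ id _ Function.bijective_id,
      diagonal_sqSing_eq M hU h]
    exact submatrix_diagonal _ _ (Fin.castLE_injective hk)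
  have h3 : (U.submatrix id (Fin.castLE hk))ᴴ * U.submatrix id (Fin.castLE hk) = 1 := by
    rw [conjTranspose_submatrix, ← submatrix_mul _ _ _ id _ Function.bijective_id, hU]
    exact submatrix_one _ (Fin.castLE_injective hk)
  rw [h2, h3, det_one, det_diagonal, ← Complex.ofReal_prod, Complex.ofReal_re] at h1
  simpa using h1

theorem normSq_mulVec_eq_sum {U : Matrix (Fin n) (Fin n) ℂ}
    (h : Mᴴ * M = U * diagonal (fun i => (sqSing M i : ℂ)) * Uᴴ) (v : Fin n → ℂ) :
    ∑ i, Complex.normSq ((M *ᵥ v) i) = ∑ i, sqSing M i * Complex.normSq ((Uᴴ *ᵥ v) i) := by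
  have h0 : ∀ w : Fin n → ℂ, ((∑ i, Complex.normSq (w i) : ℝ) : ℂ) = star w ⬝ᵥ w := by
    intro w
    simp [dotProduct, Complex.normSq_eq_conj_mul_self]
  have h1 : star (M *ᵥ v) ⬝ᵥ (M *ᵥ v) = star (Uᴴ *ᵥ v) ⬝ᵥ
      (diagonal (fun i => (sqSing M i : ℂ)) *ᵥ (Uᴴ *ᵥ v)) := by
    rw [star_mulVec, star_mulVec, ← dotProduct_mulVec, ← dotProduct_mulVec, mulVec_mulVec, h,
      conjTranspose_conjTranspose]
    simp only [mulVec_mulVec, mul_assoc]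
  have h2 : (((∑ i, Complex.normSq ((M *ᵥ v) i) : ℝ)) : ℂ) =
      ((∑ i, sqSing M i * Complex.normSq ((Uᴴ *ᵥ v) i) : ℝ) : ℂ) := by
    rw [h0, h1]
    simp only [dotProduct, mulVec_diagonal, Pi.star_apply, Complex.star_def]
    push_cast
    refine Finset.sum_congr rfl fun i _ => ?_
    rw [Complex.normSq_eq_conj_mul_self]
    ring
  exact_mod_cast h2

/-- Weyl's monotonicity principle. -/
theorem sqSing_le_of_forall_normSq_le (h : ∀ v : Fin n → ℂ,
      ∑ i, Complex.normSq ((M *ᵥ v) i) ≤ ∑ i, Complex.normSq ((N *ᵥ v) i)) (i : Fin n) :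
    sqSing M i ≤ sqSing N i := by
  obtain ⟨U, hU, hM⟩ := exists_diagonalization_sqSing M
  obtain ⟨V, hV, hN⟩ := exists_diagonalization_sqSing N
  -- The vector v must be orthogonal to the columns of U after i and to those of V before i. These
  -- are n - 1 conditions; the zero row i makes R singular and yields a non-zero v.
  let R : Matrix (Fin n) (Fin n) ℂ := fun j => if i < j then Uᴴ j else if j < i then Vᴴ j else 0
  have hR : R.det = 0 := det_eq_zero_of_row_eq_zero i fun j => by simp [R]
  obtain ⟨v, hv0, hv⟩ := exists_mulVec_eq_zero_iff.2 hR
  have hUv : ∀ j, i < j → (Uᴴ *ᵥ v) j = 0 := fun j hj => by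
    have := congrFun hv j
    simpa [mulVec, R, hj] using this
  have hVv : ∀ j, j < i → (Vᴴ *ᵥ v) j = 0 := fun j hj => by
    have := congrFun hv j
    simpa [mulVec, R, hj, hj.not_gt] using this
  have hnorm : ∀ S : Matrix (Fin n) (Fin n) ℂ, Sᴴ * S = 1 →
      ∑ j, Complex.normSq ((Sᴴ *ᵥ v) j) = ∑ j, Complex.normSq (v j) := by
    intro S hS
    have h0 : ∀ w : Fin n → ℂ, ((∑ i, Complex.normSq (w i) : ℝ) : ℂ) = star w ⬝ᵥ w := by
      intro w
      simp [dotProduct, Complex.normSq_eq_conj_mul_self]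
    have h3 : (((∑ j, Complex.normSq ((Sᴴ *ᵥ v) j) : ℝ)) : ℂ) =
        ((∑ j, Complex.normSq (v j) : ℝ) : ℂ) := by
      rw [h0, h0, star_mulVec, ← dotProduct_mulVec, mulVec_mulVec, conjTranspose_conjTranspose,
        mul_eq_one_comm.1 hS, one_mulVec]
    exact_mod_cast h3
  have hpos : 0 < ∑ j, Complex.normSq (v j) := by
    obtain ⟨j, hj⟩ := Function.ne_iff.1 hv0
    exact Finset.sum_pos' (fun _ _ => Complex.normSq_nonneg _)
      ⟨j, mem_univ _, Complex.normSq_pos.2 hj⟩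
  have h1 : sqSing M i * ∑ j, Complex.normSq (v j) ≤ ∑ j, Complex.normSq ((M *ᵥ v) j) := by
    rw [normSq_mulVec_eq_sum M hM, ← hnorm U hU, Finset.mul_sum]
    refine Finset.sum_le_sum fun j _ => ?_
    rcases lt_or_ge i j with hj | hj
    · simp [hUv j hj]
    · exact mul_le_mul_of_nonneg_right (sqSing_antitone M hj) (Complex.normSq_nonneg _)
  have h2 : ∑ j, Complex.normSq ((N *ᵥ v) j) ≤ sqSing N i * ∑ j, Complex.normSq (v j) := by
    rw [normSq_mulVec_eq_sum N hN, ← hnorm V hV, Finset.mul_sum]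
    refine Finset.sum_le_sum fun j _ => ?_
    rcases lt_or_ge j i with hj | hj
    · simp [hVv j hj]
    · exact mul_le_mul_of_nonneg_right (sqSing_antitone N hj) (Complex.normSq_nonneg _)
  exact le_of_mul_le_mul_right (h1.trans ((h v).trans h2)) hpos

theorem sqSing_diagonal_mul_le {c : Fin n → ℝ} (h0 : ∀ i, 0 ≤ c i) (h1 : ∀ i, c i ≤ 1)
    (i : Fin n) : sqSing (diagonal (fun i => (c i : ℂ)) * M) i ≤ sqSing M i := by
  refine sqSing_le_of_forall_normSq_le _ _ (fun v => Finset.sum_le_sum fun j _ => ?_) i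
  rw [← mulVec_mulVec, mulVec_diagonal, Complex.normSq_mul, Complex.normSq_ofReal]
  exact mul_le_of_le_one_left (Complex.normSq_nonneg _) (mul_le_one₀ (h1 j) (h0 j) (h1 j))

theorem sqSing_mul_diagonal_le {c : Fin n → ℝ} (h0 : ∀ i, 0 ≤ c i) (h1 : ∀ i, c i ≤ 1)
    (i : Fin n) : sqSing (M * diagonal (fun i => (c i : ℂ))) i ≤ sqSing M i := by
  rw [← sqSing_conjTranspose, ← sqSing_conjTranspose M, conjTranspose_mul,
    diagonal_conjTranspose]
  convert! sqSing_diagonal_mul_le Mᴴ h0 h1 i using 4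
  ext j
  simp

end sqSing

/-! ### Convexity from midpoint convexity. -/

/-- Doubling argument: the excess G of f over a chord at t is at most half its value at 2t or 2t -
1. A bound from above therefore improves to B / 2 ^ m for every m, and no continuity is needed. -/
theorem convexOn_of_midpoint {E : Type*} [AddCommGroup E] [Module ℝ E] {s : Set E}
    (hs : Convex ℝ s) {f : E → ℝ}
    (hmid : ∀ x ∈ s, ∀ y ∈ s, f ((1 / 2 : ℝ) • (x + y)) ≤ (f x + f y) / 2)
    (hbdd : ∀ x ∈ s, ∀ y ∈ s, ∃ C, ∀ t ∈ Set.Icc (0 : ℝ) 1, f ((1 - t) • x + t • y) ≤ C) :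
    ConvexOn ℝ s f := by
  refine ⟨hs, fun x hx y hy a b ha hb hab => ?_⟩
  obtain ⟨C, hC⟩ := hbdd x hx y hy
  have hmem : ∀ t ∈ Set.Icc (0 : ℝ) 1, (1 - t) • x + t • y ∈ s := fun t ht =>
    hs hx hy (by linarith [ht.2]) ht.1 (by ring)
  let G : ℝ → ℝ := fun t => f ((1 - t) • x + t • y) - ((1 - t) * f x + t * f y)
  let B : ℝ := |C| + |f x| + |f y|
  have hB : 0 ≤ B := by positivity
  have key : ∀ m : ℕ, ∀ t ∈ Set.Icc (0 : ℝ) 1, G t ≤ B / 2 ^ m := by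
    intro m
    induction m with
    | zero =>
      intro t ht
      have h1 := hC t ht
      have h2 : -((1 - t) * f x) ≤ |f x| := by
        calc -((1 - t) * f x) ≤ |(1 - t) * f x| := neg_le_abs _
          _ = (1 - t) * |f x| := by rw [abs_mul, abs_of_nonneg (by linarith [ht.2])]
          _ ≤ |f x| := mul_le_of_le_one_left (abs_nonneg _) (by linarith [ht.1])
      have h3 : -(t * f y) ≤ |f y| := by
        calc -(t * f y) ≤ |t * f y| := neg_le_abs _
          _ = t * |f y| := by rw [abs_mul, abs_of_nonneg ht.1]
          _ ≤ |f y| := mul_le_of_le_one_left (abs_nonneg _) ht.2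
      simp only [G, B, pow_zero, div_one]
      linarith [le_abs_self C]
    | succ m ih =>
      intro t ht
      rcases le_total t (1 / 2) with h | h
      · have ht' : 2 * t ∈ Set.Icc (0 : ℝ) 1 := ⟨by linarith [ht.1], by linarith⟩
        have h1 := hmid x hx _ (hmem _ ht')
        have h2 : (1 / 2 : ℝ) • (x + ((1 - 2 * t) • x + (2 * t) • y)) = (1 - t) • x + t • y := by
          module
        rw [h2] at h1
        have h3 := ih _ ht'
        simp only [G] at h3 ⊢
        rw [pow_succ, ← div_div]
        linarith
      · have ht' : 2 * t - 1 ∈ Set.Icc (0 : ℝ) 1 := ⟨by linarith, by linarith [ht.2]⟩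
        have h1 := hmid _ (hmem _ ht') y hy
        have h2 : (1 / 2 : ℝ) • ((1 - (2 * t - 1)) • x + (2 * t - 1) • y + y) =
            (1 - t) • x + t • y := by
          module
        rw [h2] at h1
        have h3 := ih _ ht'
        simp only [G] at h3 ⊢
        rw [pow_succ, ← div_div]
        linarith
  have hlim : Filter.Tendsto (fun m : ℕ => B / 2 ^ m) Filter.atTop (nhds 0) := by
    have := (tendsto_pow_atTop_nhds_zero_of_lt_one (r := (1 / 2 : ℝ)) (by norm_num)
      (by norm_num)).const_mul B
    simpa [div_eq_mul_inv] using this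
  have hG : G b ≤ 0 := ge_of_tendsto' hlim fun m => key m b ⟨hb, by linarith⟩
  have ha' : a = 1 - b := by linarith
  subst ha'
  simp only [G] at hG
  simpa only [smul_eq_mul] using sub_nonpos.1 hG

/-! ### Logarithmic singular values of exponential sandwiches. -/

/-- The diagonal matrix with diagonal entries `exp (α i)`. -/
noncomputable def expDiag {n : ℕ} (α : Fin n → ℝ) : Matrix (Fin n) (Fin n) ℂ :=
  diagonal fun i => (Real.exp (α i) : ℂ)

section logSing

variable {n : ℕ}

theorem expDiag_mul (α β : Fin n → ℝ) : expDiag α * expDiag β = expDiag (α + β) := by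
  rw [expDiag, expDiag, expDiag, diagonal_mul_diagonal]
  congr 1
  ext i
  rw [Pi.add_apply, Real.exp_add, Complex.ofReal_mul]

theorem expDiag_zero : expDiag (0 : Fin n → ℝ) = 1 := by
  simp [expDiag]

theorem conjTranspose_expDiag (α : Fin n → ℝ) : (expDiag α)ᴴ = expDiag α := by
  rw [expDiag, diagonal_conjTranspose]
  congr 1
  ext i
  simp [-Complex.ofReal_exp]

theorem expDiag_neg_mul (α : Fin n → ℝ) : expDiag (-α) * expDiag α = 1 := by
  rw [expDiag_mul, neg_add_cancel, expDiag_zero]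

/-- `exp (α / 2) * W * exp (β / 2)`, with `α` and `β` regarded as diagonal matrices. -/
noncomputable def expSandwich (W : Matrix (Fin n) (Fin n) ℂ) (α β : Fin n → ℝ) :
    Matrix (Fin n) (Fin n) ℂ :=
  expDiag ((1 / 2 : ℝ) • α) * W * expDiag ((1 / 2 : ℝ) • β)

/-- The logarithms of the squared singular values of `expSandwich W α β`. -/
noncomputable def logSing (W : Matrix (Fin n) (Fin n) ℂ) (α β : Fin n → ℝ) (i : Fin n) : ℝ :=
  Real.log (sqSing (expSandwich W α β) i)

variable {W : Matrix (Fin n) (Fin n) ℂ} (hW : Wᴴ * W = 1)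

include hW

theorem sqSing_expSandwich_pos (α β : Fin n → ℝ) (i : Fin n) :
    0 < sqSing (expSandwich W α β) i := by
  refine sqSing_pos _ (T := expDiag (-((1 / 2 : ℝ) • β)) * Wᴴ * expDiag (-((1 / 2 : ℝ) • α))) ?_ i
  calc _ = expDiag (-((1 / 2 : ℝ) • β)) * (Wᴴ * (expDiag (-((1 / 2 : ℝ) • α)) *
        expDiag ((1 / 2 : ℝ) • α)) * W) * expDiag ((1 / 2 : ℝ) • β) := by
        simp only [expSandwich, mul_assoc]
    _ = 1 := by rw [expDiag_neg_mul, mul_one, hW, mul_one, expDiag_neg_mul]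

theorem exp_logSing (α β : Fin n → ℝ) (i : Fin n) :
    Real.exp (logSing W α β i) = sqSing (expSandwich W α β) i :=
  Real.exp_log (sqSing_expSandwich_pos hW α β i)

theorem logSing_antitone (α β : Fin n → ℝ) : Antitone (logSing W α β) := fun _ _ hij =>
  Real.log_le_log (sqSing_expSandwich_pos hW α β _) (sqSing_antitone _ hij)

/-- The smaller sandwich is the larger one multiplied on both sides by diagonal contractions. -/
theorem logSing_mono {α β α' β' : Fin n → ℝ} (hα : α ≤ α') (hβ : β ≤ β') (i : Fin n) :
    logSing W α β i ≤ logSing W α' β' i := by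
  refine Real.log_le_log (sqSing_expSandwich_pos hW α β _) ?_
  have h1 : expSandwich W α β = expDiag ((1 / 2 : ℝ) • (α - α')) *
      (expSandwich W α' β' * expDiag ((1 / 2 : ℝ) • (β - β'))) := by
    have ha : (1 / 2 : ℝ) • α = (1 / 2 : ℝ) • (α - α') + (1 / 2 : ℝ) • α' := by module
    have hb : (1 / 2 : ℝ) • β = (1 / 2 : ℝ) • β' + (1 / 2 : ℝ) • (β - β') := by module
    rw [expSandwich, ha, hb, ← expDiag_mul, ← expDiag_mul, expSandwich]
    simp only [mul_assoc]
  rw [h1]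
  refine (sqSing_diagonal_mul_le _ (fun _ => (Real.exp_pos _).le) (fun j => ?_) i).trans
    (sqSing_mul_diagonal_le _ (fun _ => (Real.exp_pos _).le) (fun j => ?_) i)
  · have := hα j
    simp only [Real.exp_le_one_iff, Pi.smul_apply, Pi.sub_apply, smul_eq_mul]
    linarith
  · have := hβ j
    simp only [Real.exp_le_one_iff, Pi.smul_apply, Pi.sub_apply, smul_eq_mul]
    linarith

omit hW in
theorem sqSing_eq_of_diagonalization {M U : Matrix (Fin n) (Fin n) ℂ} {d : Fin n → ℝ}
    (hd : Antitone d) (hU : Uᴴ * U = 1)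
    (h : Mᴴ * M = U * diagonal (fun i => (d i : ℂ)) * Uᴴ) : sqSing M = d := by
  refine (sqSing_antitone M).eq_of_map_univ_eq hd ?_
  rw [← eigs_conjTranspose_mul_self, eigs_of_similar hU h]

theorem logSing_const (a b : ℝ) (i : Fin n) :
    logSing W (fun _ => a) (fun _ => b) i = a + b := by
  have h : ∀ c : ℝ, expDiag (fun _ : Fin n => c) = (Real.exp c : ℂ) • 1 := fun c => by
    rw [expDiag, smul_one_eq_diagonal]
  have h1 : sqSing (expSandwich W (fun _ => a) (fun _ => b)) = fun _ => Real.exp (a + b) := by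
    refine sqSing_eq_of_diagonalization (U := 1) antitone_const (by simp) ?_
    have h2 : ∀ c : ℝ, (1 / 2 : ℝ) • (fun _ : Fin n => c) = fun _ => c / 2 := fun c => by
      ext; simp; ring
    rw [expSandwich, h2, h2, h, h, ← smul_one_eq_diagonal]
    simp only [smul_mul_assoc, mul_smul_comm, conjTranspose_smul, hW, one_mul, mul_one,
      smul_smul, conjTranspose_one, Complex.star_def]
    congr 1
    rw [← Complex.ofReal_mul, Complex.conj_ofReal, ← Complex.ofReal_mul, ← Real.exp_add,
      ← Real.exp_add]
    congr 2
    ring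
  rw [logSing, h1, Real.log_exp]

theorem logSing_le {α β : Fin n → ℝ} {a b : ℝ} (ha : ∀ i, α i ≤ a) (hb : ∀ i, β i ≤ b)
    (i : Fin n) : logSing W α β i ≤ a + b :=
  (logSing_mono hW ha hb i).trans_eq (logSing_const hW a b i)

theorem logSing_add_const (α β : Fin n → ℝ) (c : ℝ) (i : Fin n) :
    logSing W (fun j => α j + c) (fun j => β j + c) i = logSing W α β i + 2 * c := by
  have h : ∀ γ : Fin n → ℝ, expDiag ((1 / 2 : ℝ) • fun j => γ j + c) =
      (Real.exp (c / 2) : ℂ) • expDiag ((1 / 2 : ℝ) • γ) := fun γ => by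
    rw [expDiag, expDiag, ← diagonal_smul]
    congr 1
    ext j
    simp only [Pi.smul_apply, smul_eq_mul]
    rw [← Complex.ofReal_mul, ← Real.exp_add]
    congr 2
    ring
  obtain ⟨U, hU, hd⟩ := exists_diagonalization_sqSing (expSandwich W α β)
  have h1 : sqSing (expSandwich W (fun j => α j + c) (fun j => β j + c)) =
      fun i => Real.exp (2 * c) * sqSing (expSandwich W α β) i := by
    refine sqSing_eq_of_diagonalization (U := U)
      (fun i j hij => mul_le_mul_of_nonneg_left (sqSing_antitone _ hij) (Real.exp_pos _).le) hU ?_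
    have h3 : expSandwich W (fun j => α j + c) (fun j => β j + c) =
        (Real.exp c : ℂ) • expSandwich W α β := by
      rw [expSandwich, h, h, expSandwich]
      simp only [smul_mul_assoc, mul_smul_comm, smul_smul]
      rw [← Complex.ofReal_mul, ← Real.exp_add]
      congr 3
      ring
    have h4 : diagonal (fun i => ((Real.exp (2 * c) * sqSing (expSandwich W α β) i : ℝ) : ℂ)) =
        (Real.exp (2 * c) : ℂ) • diagonal (fun i => (sqSing (expSandwich W α β) i : ℂ)) := by
      rw [← diagonal_smul]
      congr 1
      ext i
      simp only [Pi.smul_apply, smul_eq_mul, Complex.ofReal_mul]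
    rw [h3, h4]
    simp only [Matrix.mul_smul, Matrix.smul_mul, conjTranspose_smul, smul_smul]
    rw [← hd, Complex.star_def, Complex.conj_ofReal, ← Complex.ofReal_mul, ← Real.exp_add, two_mul]
  rw [logSing, h1, Real.log_mul (Real.exp_pos _).ne' (sqSing_expSandwich_pos hW α β i).ne',
    Real.log_exp, add_comm]
  rfl

variable {k : ℕ} (hk : k ≤ n)

theorem sum_logSing (α β : Fin n → ℝ) : ∑ i : Fin k, logSing W α β (Fin.castLE hk i) =
    Real.log (∏ i : Fin k, sqSing (expSandwich W α β) (Fin.castLE hk i)) := by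
  rw [Real.log_prod fun i _ => (sqSing_expSandwich_pos hW α β _).ne']
  rfl

/-- If A and A' are the two sandwiches, A*A' is similar to the Gram matrix of the midpoint sandwich.
Weyl's inequality bounds the eigenvalue products of A*A' by the singular value products of A and A'.
-/
theorem sum_logSing_midpoint_le (α β α' β' : Fin n → ℝ) :
    ∑ i : Fin k, logSing W ((1 / 2 : ℝ) • (α + α')) ((1 / 2 : ℝ) • (β + β')) (Fin.castLE hk i) ≤
      (∑ i : Fin k, logSing W α β (Fin.castLE hk i) +
        ∑ i : Fin k, logSing W α' β' (Fin.castLE hk i)) / 2 := by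
  have hpos : ∀ γ δ : Fin n → ℝ,
      0 < ∏ i : Fin k, sqSing (expSandwich W γ δ) (Fin.castLE hk i) := fun γ δ =>
    Finset.prod_pos fun i _ => sqSing_expSandwich_pos hW γ δ _
  obtain ⟨U, hU, hd⟩ := exists_diagonalization_sqSing
    (expSandwich W ((1 / 2 : ℝ) • (α + α')) ((1 / 2 : ℝ) • (β + β')))
  -- Conjugation by exp((β - β')/4) balances the outer factors exp(β/2) and exp(β'/2) into two
  -- copies of exp((β + β')/4).
  have hZ : (expSandwich W α β)ᴴ * expSandwich W α' β' =
      (expDiag ((1 / 4 : ℝ) • (β - β')) * U) * diagonal (fun i => (sqSing (expSandwich W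
        ((1 / 2 : ℝ) • (α + α')) ((1 / 2 : ℝ) • (β + β'))) i : ℂ)) *
        (Uᴴ * expDiag (-((1 / 4 : ℝ) • (β - β')))) := by
    have h1 : (expDiag ((1 / 4 : ℝ) • (β - β')) * U) * diagonal (fun i => (sqSing (expSandwich W
        ((1 / 2 : ℝ) • (α + α')) ((1 / 2 : ℝ) • (β + β'))) i : ℂ)) *
        (Uᴴ * expDiag (-((1 / 4 : ℝ) • (β - β')))) = expDiag ((1 / 4 : ℝ) • (β - β')) *
        (U * diagonal (fun i => (sqSing (expSandwich W
        ((1 / 2 : ℝ) • (α + α')) ((1 / 2 : ℝ) • (β + β'))) i : ℂ)) * Uᴴ) *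
        expDiag (-((1 / 4 : ℝ) • (β - β'))) := by
      simp only [mul_assoc]
    rw [h1, ← hd]
    simp only [expSandwich, conjTranspose_mul, conjTranspose_expDiag]
    have h2 : expDiag ((1 / 2 : ℝ) • β) = expDiag ((1 / 4 : ℝ) • (β - β')) *
        expDiag ((1 / 2 : ℝ) • (1 / 2 : ℝ) • (β + β')) := by
      rw [expDiag_mul]
      congr 1
      module
    have h3 : expDiag ((1 / 2 : ℝ) • β') = expDiag ((1 / 2 : ℝ) • (1 / 2 : ℝ) • (β + β')) *
        expDiag (-((1 / 4 : ℝ) • (β - β'))) := by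
      rw [expDiag_mul]
      congr 1
      module
    have h4 : expDiag ((1 / 2 : ℝ) • α) * expDiag ((1 / 2 : ℝ) • α') =
        expDiag ((1 / 2 : ℝ) • (1 / 2 : ℝ) • (α + α')) *
        expDiag ((1 / 2 : ℝ) • (1 / 2 : ℝ) • (α + α')) := by
      rw [expDiag_mul, expDiag_mul]
      congr 1
      module
    calc _ = expDiag ((1 / 2 : ℝ) • β) * Wᴴ * (expDiag ((1 / 2 : ℝ) • α) *
          expDiag ((1 / 2 : ℝ) • α')) * W * expDiag ((1 / 2 : ℝ) • β') := by
          simp only [mul_assoc]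
      _ = _ := by
          rw [h4, h2, h3]
          simp only [mul_assoc]
  have hTS : (Uᴴ * expDiag (-((1 / 4 : ℝ) • (β - β')))) *
      (expDiag ((1 / 4 : ℝ) • (β - β')) * U) = 1 := by
    rw [mul_assoc, ← mul_assoc (expDiag _), expDiag_neg_mul, one_mul, hU]
  have hG : GramBound k ((expSandwich W α β)ᴴ * expSandwich W α' β')
      ((∏ i : Fin k, sqSing (expSandwich W α β) (Fin.castLE hk i)) *
        ∏ i : Fin k, sqSing (expSandwich W α' β') (Fin.castLE hk i)) := by
    have := gramBound_prod_sqSing (expSandwich W α β)ᴴ hk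
    rw [sqSing_conjTranspose] at this
    exact this.mul (hpos α β).le (gramBound_prod_sqSing _ hk)
  have h5 := Real.log_le_log (pow_pos (hpos _ _) 2) (hG.prod_eigenvalues_sq_le hk hTS hZ)
  rw [Real.log_pow, Real.log_mul (hpos _ _).ne' (hpos _ _).ne', ← sum_logSing hW,
    ← sum_logSing hW, ← sum_logSing hW] at h5
  push_cast at h5
  linarith

theorem convexOn_sum_logSing : ConvexOn ℝ Set.univ fun z : (Fin n → ℝ) × (Fin n → ℝ) =>
    ∑ i : Fin k, logSing W z.1 z.2 (Fin.castLE hk i) := by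
  refine convexOn_of_midpoint convex_univ
    (fun x _ y _ => sum_logSing_midpoint_le hW hk x.1 x.2 y.1 y.2) fun x _ y _ => ?_
  refine ⟨∑ i : Fin k, logSing W (x.1 ⊔ y.1) (x.2 ⊔ y.2) (Fin.castLE hk i), fun t ht =>
    Finset.sum_le_sum fun i _ => logSing_mono hW (fun j => ?_) (fun j => ?_) _⟩
  · exact Convex.combo_le_max (x.1 j) (y.1 j) (by linarith [ht.2]) ht.1 (by ring)
  · exact Convex.combo_le_max (x.2 j) (y.2 j) (by linarith [ht.2]) ht.1 (by ring)

/-- Joint convexity splits φ into its truncations. For a single truncation at τ, monotonicity bounds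
each entry both by the untruncated entry and by 2τ, the value at constant exponents τ. The factor 2
appears because φ acts on both arguments. -/
theorem sum_logSing_comp_le {ι : Type*} (s : Finset ι) {w τ : ι → ℝ} (hw : ∀ j ∈ s, 0 ≤ w j)
    (hw1 : ∑ j ∈ s, w j = 1) {c : ℝ} {φ : ℝ → ℝ}
    (hφ : ∀ v, φ v = ∑ j ∈ s, w j * min v (τ j) + c) (α β : Fin n → ℝ) :
    ∑ i : Fin k, logSing W (φ ∘ α) (φ ∘ β) (Fin.castLE hk i) ≤
      ∑ i : Fin k, 2 * φ (logSing W α β (Fin.castLE hk i) / 2) := by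
  have hsum : ∀ γ : Fin n → ℝ,
      φ ∘ γ = fun i => (∑ j ∈ s, w j • fun i => min (γ i) (τ j)) i + c := by
    intro γ
    ext i
    simp [hφ, Finset.sum_apply]
  have h1 := (convexOn_sum_logSing hW hk).map_sum_le (t := s) (w := w)
    (p := fun j => (fun i => min (α i) (τ j), fun i => min (β i) (τ j))) hw hw1
    (fun _ _ => Set.mem_univ _)
  simp only [Prod.fst_sum, Prod.snd_sum, Prod.smul_fst, Prod.smul_snd, smul_eq_mul] at h1
  rw [hsum, hsum]
  simp only [logSing_add_const hW, Finset.sum_add_distrib]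
  have h2 : ∀ j ∈ s, w j * ∑ i : Fin k, logSing W (fun i => min (α i) (τ j))
      (fun i => min (β i) (τ j)) (Fin.castLE hk i) ≤
      w j * ∑ i : Fin k, 2 * min (logSing W α β (Fin.castLE hk i) / 2) (τ j) := by
    intro j hj
    refine mul_le_mul_of_nonneg_left (Finset.sum_le_sum fun i _ => ?_) (hw j hj)
    have h3 := logSing_mono hW (α := fun i => min (α i) (τ j)) (β := fun i => min (β i) (τ j))
      (fun i => min_le_left (α i) _) (fun i => min_le_left (β i) _) (Fin.castLE hk i)
    have h4 := logSing_le hW (α := fun i => min (α i) (τ j)) (β := fun i => min (β i) (τ j))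
      (fun i => min_le_right (α i) _) (fun i => min_le_right (β i) _) (Fin.castLE hk i)
    rw [mul_min_of_nonneg _ _ (by norm_num : (0 : ℝ) ≤ 2)]
    exact le_min (by linarith) (by linarith)
  refine (add_le_add_left (h1.trans (Finset.sum_le_sum h2)) _).trans_eq ?_
  simp only [hφ, Finset.mul_sum, mul_add, Finset.sum_add_distrib]
  congr 1
  rw [Finset.sum_comm]
  refine Finset.sum_congr rfl fun _ _ => Finset.sum_congr rfl fun _ _ => by ring

end logSing

/-! ### Weak majorisation and concave interpolation of an inverse. -/

/-- Abel summation in inductive form: since partial sums of x are non-negative, passing to the next,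
smaller multiplier only decreases the left side. -/
theorem mul_sum_le_sum_mul_of_antitone {n : ℕ} {p x : Fin n → ℝ} (hp : Antitone p)
    (hx : ∀ m (hm : m ≤ n), 0 ≤ ∑ i : Fin m, x (Fin.castLE hm i)) (m : ℕ) (hm : m + 1 ≤ n) :
    p ⟨m, hm⟩ * ∑ i : Fin (m + 1), x (Fin.castLE hm i) ≤
      ∑ i : Fin (m + 1), p (Fin.castLE hm i) * x (Fin.castLE hm i) := by
  induction m with
  | zero =>
    simp
    exact le_rfl
  | succ m ih =>
    have h1 := ih (by omega)
    rw [Fin.sum_univ_castSucc, Fin.sum_univ_castSucc (n := m + 1), mul_add]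
    have h2 : p ⟨m + 1, hm⟩ ≤ p ⟨m, by omega⟩ := hp (by simp)
    have h3 := mul_le_mul_of_nonneg_right h2 (hx (m + 1) (by omega))
    exact add_le_add (h3.trans h1) le_rfl

/-- The Tomić–Weyl inequality for weak majorisation. -/
theorem sum_le_sum_of_weakMajorization {n : ℕ} {J : Set ℝ} (hJ : IsOpen J) {h : ℝ → ℝ}
    (hconv : ConvexOn ℝ J h) (hmono : MonotoneOn h J) {a b : Fin n → ℝ} (ha : Antitone a)
    (haJ : ∀ i, a i ∈ J) (hbJ : ∀ i, b i ∈ J)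
    (hab : ∀ m (hm : m ≤ n), ∑ i : Fin m, a (Fin.castLE hm i) ≤ ∑ i : Fin m, b (Fin.castLE hm i)) :
    ∀ m (hm : m ≤ n),
      ∑ i : Fin m, h (a (Fin.castLE hm i)) ≤ ∑ i : Fin m, h (b (Fin.castLE hm i)) := by
  intro m hm
  -- The right derivative serves as a subgradient at every point of the open set J.
  let D : ℝ → ℝ := fun x => derivWithin h (Set.Ioi x) x
  have hint : interior J = J := hJ.interior_eq
  have hsub : ∀ x ∈ J, ∀ y ∈ J, D x * (y - x) ≤ h y - h x := by
    intro x hx y hy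
    rcases lt_trichotomy x y with hxy | rfl | hxy
    · have h1 := hconv.rightDeriv_le_slope_of_mem_interior (hint.symm ▸ hx) hy hxy
      rwa [slope_def_field, le_div_iff₀ (sub_pos.2 hxy)] at h1
    · simp
    · have h1 := (hconv.slope_le_leftDeriv_of_mem_interior hy (hint.symm ▸ hx) hxy).trans
        (hconv.leftDeriv_le_rightDeriv_of_mem_interior (hint.symm ▸ hx))
      rw [slope_def_field, div_le_iff₀ (sub_pos.2 hxy)] at h1
      simp only [D]
      linarith
  have hD0 : ∀ x ∈ J, 0 ≤ D x := by
    intro x hx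
    obtain ⟨y, hyx, hy⟩ := (mem_nhds_iff_exists_Ioo_subset.1 (hJ.mem_nhds hx)) |> fun ⟨l, u, hlu, hs⟩ =>
      (⟨(l + x) / 2, by linarith [hlu.1], hs ⟨by linarith [hlu.1], by linarith [hlu.1, hlu.2]⟩⟩ :
        ∃ y, y < x ∧ y ∈ J)
    have h1 := hsub x hx y hy
    have h2 := hmono hy hx hyx.le
    by_contra hneg
    push Not at hneg
    nlinarith [mul_pos_of_neg_of_neg hneg (sub_neg.2 hyx)]
  have hDm : Antitone fun i => D (a i) := fun i j hij =>
    hconv.monotoneOn_rightDeriv (hint.symm ▸ haJ j) (hint.symm ▸ haJ i) (ha hij)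
  have hx : ∀ m (hm : m ≤ n), 0 ≤ ∑ i : Fin m, (b - a) (Fin.castLE hm i) := by
    intro m hm
    simp only [Pi.sub_apply, Finset.sum_sub_distrib]
    linarith [hab m hm]
  have h0 : 0 ≤ ∑ i : Fin m, D (a (Fin.castLE hm i)) * (b - a) (Fin.castLE hm i) := by
    cases m with
    | zero => simp
    | succ m =>
      exact (mul_nonneg (hD0 _ (haJ _)) (hx _ hm)).trans
        (mul_sum_le_sum_mul_of_antitone hDm hx m hm)
  have h1 : ∑ i : Fin m, D (a (Fin.castLE hm i)) * (b - a) (Fin.castLE hm i) ≤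
      ∑ i : Fin m, (h (b (Fin.castLE hm i)) - h (a (Fin.castLE hm i))) :=
    Finset.sum_le_sum fun i _ => hsub _ (haJ _) _ (hbJ _)
  rw [Finset.sum_sub_distrib] at h1
  linarith

/-- An expansive convex function has a piecewise affine concave approximate inverse,
exact on a given finite set. -/
theorem exists_concave_interpolation {J : Set ℝ} (hJ : IsLowerSet J) {h : ℝ → ℝ}
    (hconv : ConvexOn ℝ J h) (hexp : ∀ x ∈ J, ∀ y ∈ J, x ≤ y → y - x ≤ h y - h x)
    (S : Finset ℝ) (hS : S.Nonempty) (hSJ : ∀ x ∈ S, x ∈ J) :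
    ∃ (ι : Type) (_ : Fintype ι) (w τ : ι → ℝ) (c : ℝ) (φ : ℝ → ℝ), (∀ j, 0 ≤ w j) ∧
      ∑ j, w j = 1 ∧ (∀ v, φ v = ∑ j, w j * min v (τ j) + c) ∧
      (∀ x ∈ S, φ (h x) = x) ∧ ∀ v, φ v ∈ J ∧ h (φ v) ≤ v := by
  -- For induction on the largest point M, the weight σ of the last kink h M is kept apart: it is
  -- the slope of φ just before h M. The last clause says that chords of the inverse of h starting
  -- at M have slope at most σ.
  suffices H : ∃ (ι : Type) (_ : Fintype ι) (w τ : ι → ℝ) (c : ℝ) (φ : ℝ → ℝ) (σ M : ℝ),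
      (∀ j, 0 ≤ w j) ∧ 0 ≤ σ ∧ ∑ j, w j + σ = 1 ∧
      (∀ v, φ v = ∑ j, w j * min v (τ j) + σ * min v (h M) + c) ∧
      (∀ x ∈ S, φ (h x) = x) ∧ (∀ v, φ v ∈ J ∧ h (φ v) ≤ v) ∧ M ∈ S ∧ (∀ x ∈ S, x ≤ M) ∧
      (∀ v, h M ≤ v → φ v = M) ∧ ∀ y ∈ J, M ≤ y → y - M ≤ σ * (h y - h M) by
    obtain ⟨ι, _, w, τ, c, φ, σ, M, hw, hσ, h1, h2, h3, h4, -⟩ := H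
    refine ⟨Option ι, inferInstance, fun o => o.elim σ w, fun o => o.elim (h M) τ, c, φ, ?_, ?_,
      ?_, h3, h4⟩
    · rintro (_ | j)
      exacts [hσ, hw j]
    · simpa [Fintype.sum_option, add_comm] using h1
    · intro v
      rw [h2 v]
      simp [Fintype.sum_option, add_comm]
  induction S using Finset.induction_on_max with
  | empty => simp at hS
  | insert x S hx ih =>
    have hxJ : x ∈ J := hSJ x (mem_insert_self _ _)
    rcases S.eq_empty_or_nonempty with rfl | hne
    -- For one point, φ is the line of slope 1 through (h x, x), capped at x. Expansiveness gives h
    -- ∘ φ ≤ id to its left.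
    · refine ⟨Empty, inferInstance, fun _ => 0, fun _ => 0, x - h x,
        fun v => min v (h x) + (x - h x), 1, x, by simp, by simp, by simp, by simp, by simp,
        fun v => ?_, by simp, by simp, fun v hv => by simp [hv], fun y hy hxy => ?_⟩
      · beta_reduce
        rcases le_total v (h x) with hv | hv
        · rw [min_eq_left hv]
          have hle : v + (x - h x) ≤ x := by linarith
          have hm := hJ hle hxJ
          exact ⟨hm, by linarith [hexp _ hm x hxJ hle]⟩
        · rw [min_eq_right hv, add_sub_cancel]
          exact ⟨hxJ, hv⟩
      · rw [one_mul]
        exact hexp x hxJ y hy hxy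
    · obtain ⟨ι, _, w, τ, c, φ, σ, M, hw, hσ, h1, h2, h3, h4, hMS, hM, h5, h6⟩ :=
        ih hne fun y hy => hSJ y (mem_insert_of_mem hy)
      have hMx : M < x := hx M hMS
      have hMJ : M ∈ J := hSJ M (mem_insert_of_mem hMS)
      have hh : x - M ≤ h x - h M := hexp M hMJ x hxJ hMx.le
      have hd : 0 < h x - h M := by linarith
      -- The chord slope of the inverse on [h M, h x]. Of the weight σ at the kink h M, the part ρ
      -- moves to the new kink h x, so the total stays 1.
      let ρ : ℝ := (x - M) / (h x - h M)
      have hρ0 : 0 ≤ ρ := div_nonneg (by linarith) hd.le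
      have hρσ : ρ ≤ σ := by
        rw [div_le_iff₀ hd]
        exact h6 x hxJ hMx.le
      have hρ : ρ * (h x - h M) = x - M := div_mul_cancel₀ _ hd.ne'
      have hlow : ∀ v, v ≤ h M → φ v + ρ * (min v (h x) - min v (h M)) = φ v := fun v hv => by
        rw [min_eq_left hv, min_eq_left (by linarith), sub_self, mul_zero, add_zero]
      have hhigh : ∀ v, h x ≤ v → φ v + ρ * (min v (h x) - min v (h M)) = x := fun v hv => by
        rw [min_eq_right hv, min_eq_right (by linarith), hρ, h5 v (by linarith)]
        ring
      refine ⟨Option ι, inferInstance, fun o => o.elim (σ - ρ) w, fun o => o.elim (h M) τ, c,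
        fun v => φ v + ρ * (min v (h x) - min v (h M)), ρ, x, ?_, hρ0, ?_, ?_, ?_, ?_,
        mem_insert_self _ _, ?_,
        hhigh, ?_⟩
      · rintro (_ | j)
        exacts [sub_nonneg.2 hρσ, hw j]
      · simp only [Fintype.sum_option, Option.elim]
        linarith
      · intro v
        simp only [Fintype.sum_option, Option.elim, h2]
        ring
      · intro y hy
        rcases mem_insert.1 hy with rfl | hy
        · exact hhigh _ le_rfl
        · have hyJ := hSJ y (mem_insert_of_mem hy)
          have := hexp y hyJ M hMJ (hM y hy)
          simp only
          rw [hlow _ (by linarith [hM y hy]), h3 y hy]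
      · intro v
        rcases le_total v (h M) with hv | hv
        · simp only [hlow v hv]
          exact h4 v
        · rcases le_total (h x) v with hv' | hv'
          · simp only [hhigh v hv']
            exact ⟨hxJ, hv'⟩
          · simp only [min_eq_left hv', min_eq_right hv, h5 v hv]
            -- On the new segment φ inverts the chord of h, and the convex h lies below that chord.
            let t : ℝ := (v - h M) / (h x - h M)
            have ht0 : 0 ≤ t := div_nonneg (by linarith) hd.le
            have ht1 : t ≤ 1 := (div_le_one hd).2 (by linarith)
            have ht : t * (h x - h M) = v - h M := div_mul_cancel₀ _ hd.ne'
            have hc := hconv.2 hMJ hxJ (sub_nonneg.2 ht1) ht0 (by ring)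
            have he : (1 - t) • M + t • x = M + ρ * (v - h M) := by
              rw [← ht]
              simp only [smul_eq_mul]
              linear_combination (-t) * hρ
            rw [he] at hc
            have hle : M + ρ * (v - h M) ≤ x := by
              have := mul_le_mul_of_nonneg_left (sub_le_sub_right hv' (h M)) hρ0
              linarith
            refine ⟨hJ hle hxJ, hc.trans_eq ?_⟩
            simp only [smul_eq_mul]
            linear_combination ht
      · intro y hy
        rcases mem_insert.1 hy with rfl | hy
        · exact le_rfl
        · exact (hx y hy).le
      · intro y hy hxy
        rcases hxy.eq_or_lt with rfl | hxy
        · simp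
        · have h7 := hconv.slope_mono_adjacent hMJ hy hMx hxy
          rw [div_le_div_iff₀ (by linarith) (by linarith)] at h7
          rw [div_mul_eq_mul_div, le_div_iff₀ hd]
          linarith

/-! ### Class B in logarithmic coordinates. -/

/-- The set of logarithms of the positive points of `dom x₀`. -/
def logDom (x₀ : EReal) : Set ℝ := {u | (Real.exp u : EReal) < x₀}

theorem exp_mem_dom {x₀ : EReal} {u : ℝ} (hu : u ∈ logDom x₀) : Real.exp u ∈ dom x₀ :=
  ⟨(Real.exp_pos u).le, hu⟩

theorem log_mem_logDom {x₀ : EReal} {x : ℝ} (hx : x ∈ dom x₀) (h0 : 0 < x) :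
    Real.log x ∈ logDom x₀ := by
  rw [logDom, Set.mem_ofPred_eq, Real.exp_log h0]
  exact hx.2

theorem isLowerSet_logDom (x₀ : EReal) : IsLowerSet (logDom x₀) := fun _ _ hba ha =>
  lt_of_le_of_lt (EReal.coe_le_coe_iff.2 (Real.exp_le_exp.2 hba)) ha

theorem isOpen_logDom (x₀ : EReal) : IsOpen (logDom x₀) :=
  isOpen_Iio.preimage (continuous_coe_real_ereal.comp Real.continuous_exp)

theorem convex_logDom (x₀ : EReal) : Convex ℝ (logDom x₀) :=
  (isLowerSet_logDom x₀).ordConnected.convex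

theorem sqrt_exp_mul_exp (u v : ℝ) :
    Real.sqrt (Real.exp u * Real.exp v) = Real.exp ((1 / 2 : ℝ) * (u + v)) := by
  rw [← Real.exp_add, Real.sqrt_eq_iff_mul_self_eq (Real.exp_pos _).le (Real.exp_pos _).le,
    ← Real.exp_add]
  congr 1
  ring

theorem exists_mem_logDom {x₀ : EReal} (hx₀ : 0 < x₀) : ∃ u, u ∈ logDom x₀ := by
  obtain ⟨y, h0, hy⟩ := EReal.exists_between_coe_real hx₀
  have h0' : 0 < y := by exact_mod_cast h0
  exact ⟨Real.log y, log_mem_logDom ⟨h0'.le, hy⟩ h0'⟩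

theorem ContinuousOn.comp_exp {x₀ : EReal} {g : ℝ → ℝ} (hg : ContinuousOn g (dom x₀)) :
    ContinuousOn (fun u => g (Real.exp u)) (logDom x₀) :=
  hg.comp Real.continuous_exp.continuousOn fun _ hu => exp_mem_dom hu

/-- `log ∘ g ∘ exp`. -/
noncomputable def logConj (g : ℝ → ℝ) (u : ℝ) : ℝ := Real.log (g (Real.exp u))

namespace ClassB

variable {x₀ : EReal} {g : ℝ → ℝ} (hg : ClassB x₀ g)

include hg

theorem midpoint_le {u v : ℝ} (hu : u ∈ logDom x₀) (hv : v ∈ logDom x₀) :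
    g (Real.exp ((1 / 2 : ℝ) * (u + v))) ≤ Real.sqrt (g (Real.exp u) * g (Real.exp v)) := by
  rw [← sqrt_exp_mul_exp]
  exact hg.geomConvex _ (exp_mem_dom hu) _ (exp_mem_dom hv)

/-- Geometric convexity carries a zero to the midpoint with any other point. To the left, v is the
midpoint of u and 2v - u; to the right, repeated midpoints with v converge to v, and continuity
concludes. Hence g vanishes at all positive points or at none. -/
theorem exp_eq_zero_of_exp_eq_zero {u v : ℝ} (hu : u ∈ logDom x₀) (hv : v ∈ logDom x₀)
    (h0 : g (Real.exp u) = 0) : g (Real.exp v) = 0 := by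
  have step : ∀ s ∈ logDom x₀, ∀ t ∈ logDom x₀, g (Real.exp s) = 0 →
      g (Real.exp ((1 / 2 : ℝ) * (s + t))) = 0 := by
    intro s hs t ht h
    have h1 := hg.midpoint_le hs ht
    rw [h, zero_mul, Real.sqrt_zero] at h1
    have h2 : (1 / 2 : ℝ) * (s + t) ∈ logDom x₀ := by
      have := convex_logDom x₀ hs ht (a := 1 / 2) (b := 1 / 2) (by norm_num) (by norm_num)
        (by norm_num)
      rwa [← smul_add, smul_eq_mul] at this
    exact le_antisymm h1 (hg.nonneg _ (exp_mem_dom h2))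
  rcases le_total v u with hvu | huv
  · have := step u hu (2 * v - u) (isLowerSet_logDom x₀ (by linarith) hv) h0
    rwa [show (1 / 2 : ℝ) * (u + (2 * v - u)) = v by ring] at this
  · have hm : ∀ m : ℕ, v - (v - u) * (1 / 2) ^ m ∈ logDom x₀ := fun m =>
      isLowerSet_logDom x₀ (by
        have : 0 ≤ (v - u) * (1 / 2) ^ m := mul_nonneg (by linarith) (by positivity)
        linarith) hv
    have hz : ∀ m : ℕ, g (Real.exp (v - (v - u) * (1 / 2) ^ m)) = 0 := by
      intro m
      induction m with
      | zero => simpa using h0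
      | succ m ih =>
        have := step _ (hm m) v hv ih
        rw [← this]
        congr 2
        ring
    have ht : Filter.Tendsto (fun m : ℕ => v - (v - u) * (1 / 2) ^ m) Filter.atTop (nhds v) := by
      have := ((tendsto_pow_atTop_nhds_zero_of_lt_one (r := (1 / 2 : ℝ)) (by norm_num)
        (by norm_num)).const_mul (v - u)).const_sub v
      simpa using this
    have hc := (hg.continuousOn.comp_exp.continuousAt
      ((isOpen_logDom x₀).mem_nhds hv)).tendsto.comp ht
    refine tendsto_nhds_unique hc ?_
    simp [Function.comp_def, hz, -one_div]

theorem exp_pos_of_ne_zero {u v : ℝ} (hu : u ∈ logDom x₀) (h0 : g (Real.exp u) ≠ 0)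
    (hv : v ∈ logDom x₀) : 0 < g (Real.exp v) :=
  lt_of_le_of_ne (hg.nonneg _ (exp_mem_dom hv)) fun h =>
    h0 (hg.exp_eq_zero_of_exp_eq_zero hv hu h.symm)

variable (hpos : ∀ u ∈ logDom x₀, 0 < g (Real.exp u))

include hpos

theorem convexOn_logConj : ConvexOn ℝ (logDom x₀) (logConj g) := by
  have hcont : ContinuousOn (logConj g) (logDom x₀) :=
    hg.continuousOn.comp_exp.log fun u hu => (hpos u hu).ne'
  refine convexOn_of_midpoint (convex_logDom x₀) (fun u hu v hv => ?_) fun u hu v hv => ?_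
  · have h2 : (1 / 2 : ℝ) * (u + v) ∈ logDom x₀ := by
      have := convex_logDom x₀ hu hv (a := 1 / 2) (b := 1 / 2) (by norm_num) (by norm_num)
        (by norm_num)
      rwa [← smul_add, smul_eq_mul] at this
    have h1 := Real.log_le_log (hpos _ h2) (hg.midpoint_le hu hv)
    rw [Real.log_sqrt (mul_pos (hpos u hu) (hpos v hv)).le,
      Real.log_mul (hpos u hu).ne' (hpos v hv).ne'] at h1
    exact h1
  · have h1 : ContinuousOn (fun t : ℝ => logConj g ((1 - t) • u + t • v)) (Set.Icc 0 1) :=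
      hcont.comp (by fun_prop) fun t ht =>
        convex_logDom x₀ hu hv (by linarith [ht.2]) ht.1 (by ring)
    obtain ⟨C, hC⟩ := isCompact_Icc.bddAbove_image h1
    exact ⟨C, fun t ht => hC ⟨t, ht, rfl⟩⟩

/-- By the chain rule, h'(w) = x g'(x) / g(x) at x = exp w. -/
theorem one_le_deriv_logConj {w d : ℝ} (hw : w ∈ logDom x₀) (hd : HasDerivAt (logConj g) d w) :
    1 ≤ d := by
  have h1 : HasDerivAt (fun x => Real.exp (logConj g (Real.log x)))
      (g (Real.exp w) * (d * (Real.exp w)⁻¹)) (Real.exp w) := by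
    have h2 := Real.hasDerivAt_log (Real.exp_pos w).ne'
    have h3 : HasDerivAt (logConj g) d (Real.log (Real.exp w)) := by rwa [Real.log_exp]
    have h4 := (h3.comp _ h2).exp
    convert! h4 using 1
    rw [Function.comp, Real.log_exp, logConj, Real.exp_log (hpos w hw)]
  have h5 : HasDerivAt g (g (Real.exp w) * (d * (Real.exp w)⁻¹)) (Real.exp w) := by
    refine h1.congr_of_eventuallyEq ?_
    have hn : Real.log ⁻¹' logDom x₀ ∈ nhds (Real.exp w) :=
      (Real.continuousAt_log (Real.exp_pos w).ne').preimage_mem_nhds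
        ((isOpen_logDom x₀).mem_nhds (by rwa [Real.log_exp]))
    filter_upwards [hn, lt_mem_nhds (Real.exp_pos w)] with x hx h0
    have h6 := hpos _ hx
    rw [Real.exp_log h0] at h6
    rw [logConj, Real.exp_log h0, Real.exp_log h6]
  have h6 := hg.le_mul_deriv _ (exp_mem_dom hw) _ h5.hasDerivWithinAt
  have h7 : Real.exp w * (g (Real.exp w) * (d * (Real.exp w)⁻¹)) = d * g (Real.exp w) := by
    field_simp
  rw [h7] at h6
  nlinarith [hpos w hw]

/-- The derivative condition speaks only where g is differentiable. A convex function is locally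
Lipschitz, hence differentiable almost everywhere, so some w < x has h'(w) ≥ 1; convexity carries
this bound to all chords further right. -/
theorem sub_le_logConj_sub {x y : ℝ} (hx : x ∈ logDom x₀) (hy : y ∈ logDom x₀) (hxy : x ≤ y) :
    y - x ≤ logConj g y - logConj g x := by
  rcases hxy.eq_or_lt with rfl | hxy
  · simp
  have hconv := hg.convexOn_logConj hpos
  have hx1 : x - 1 ∈ logDom x₀ := isLowerSet_logDom x₀ (by linarith) hx
  obtain ⟨K, t, ht, hK⟩ := hconv.locallyLipschitzOn (isOpen_logDom x₀) hx1
  rw [(isOpen_logDom x₀).nhdsWithin_eq hx1] at ht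
  obtain ⟨l, r, hlr, hsub⟩ := mem_nhds_iff_exists_Ioo_subset.1
    (Filter.inter_mem ht (Iio_mem_nhds (by linarith : x - 1 < x)))
  have hL : LipschitzOnWith K (logConj g) (Set.Ioo l r) := hK.mono fun z hz => (hsub hz).1
  obtain ⟨w, hw, hdiff⟩ := MeasureTheory.Measure.exists_mem_of_measure_ne_zero_of_ae
    (μ := MeasureTheory.volume) (s := Set.Ioo l r)
    (by simp only [Real.volume_Ioo, ne_eq, ENNReal.ofReal_eq_zero, not_le]
        linarith [hlr.1, hlr.2])
    (hL.ae_differentiableWithinAt_real measurableSet_Ioo)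
  have hwx : w < x := (hsub hw).2
  have hwJ : w ∈ logDom x₀ := isLowerSet_logDom x₀ hwx.le hx
  have hd := (hdiff.differentiableAt (Ioo_mem_nhds hw.1 hw.2)).hasDerivAt
  have h1 := hg.one_le_deriv_logConj hpos hwJ hd
  have h2 := hconv.le_slope_of_hasDerivAt hwJ hx hwx hd
  have h3 := hconv.slope_mono_adjacent hwJ hy hwx hxy
  rw [slope_def_field] at h2
  have h4 := h1.trans (h2.trans h3)
  rwa [le_div_iff₀ (by linarith), one_mul] at h4

omit hpos in
-- Slopes of h at least 1 mean g(e^v) ≤ C e^v as v → -∞; continuity at 0 finishes.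
theorem map_zero (hx₀ : 0 < x₀) : g 0 = 0 := by
  obtain ⟨u, hu⟩ := exists_mem_logDom hx₀
  have hC : ∃ C, ∀ v ≤ u, g (Real.exp v) ≤ C * Real.exp v := by
    by_cases h0 : g (Real.exp u) = 0
    · refine ⟨0, fun v hv => ?_⟩
      rw [hg.exp_eq_zero_of_exp_eq_zero hu (isLowerSet_logDom x₀ hv hu) h0, zero_mul]
    · refine ⟨Real.exp (logConj g u - u), fun v hv => ?_⟩
      have hvJ := isLowerSet_logDom x₀ hv hu
      have hpos := fun w (hw : w ∈ logDom x₀) => hg.exp_pos_of_ne_zero hu h0 hw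
      have h1 := hg.sub_le_logConj_sub hpos hvJ hu hv
      rw [← Real.exp_add, ← Real.exp_log (hpos v hvJ)]
      exact Real.exp_le_exp.2 (by rw [logConj, logConj] at *; linarith)
  obtain ⟨C, hC⟩ := hC
  have h0mem : (0 : ℝ) ∈ dom x₀ := ⟨le_rfl, by exact_mod_cast hx₀⟩
  have ht : Filter.Tendsto Real.exp Filter.atBot (nhdsWithin 0 (dom x₀)) := by
    refine tendsto_nhdsWithin_iff.2 ⟨Real.tendsto_exp_atBot, ?_⟩
    filter_upwards [Filter.eventually_le_atBot u] with v hv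
    exact exp_mem_dom (isLowerSet_logDom x₀ hv hu)
  have h1 := (hg.continuousOn 0 h0mem).tendsto.comp ht
  have h2 : Filter.Tendsto (fun v => C * Real.exp v) Filter.atBot (nhds 0) := by
    simpa using Real.tendsto_exp_atBot.const_mul C
  refine le_antisymm (le_of_tendsto_of_tendsto h1 h2 ?_) (hg.nonneg 0 h0mem)
  filter_upwards [Filter.eventually_le_atBot u] with v hv
  exact hC v hv

end ClassB

/-! ### From class B to log-submajorisation. -/

theorem eigs_expDiag_mul {n : ℕ} {U V : Matrix (Fin n) (Fin n) ℂ} (α β : Fin n → ℝ) :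
    eigs (U * expDiag α * Uᴴ * (V * expDiag β * Vᴴ)) =
      univ.val.map (sqSing (expSandwich (Uᴴ * V) α β)) := by
  have h : ∀ γ : Fin n → ℝ, expDiag γ = expDiag ((1 / 2 : ℝ) • γ) * expDiag ((1 / 2 : ℝ) • γ) :=
    fun γ => by
      rw [expDiag_mul]
      congr 1
      module
  rw [← eigs_conjTranspose_mul_self, h α, h β, expSandwich]
  simp only [conjTranspose_mul, conjTranspose_conjTranspose, conjTranspose_expDiag]
  have h1 : ∀ P Q : Matrix (Fin n) (Fin n) ℂ, U * (P * P) * Uᴴ * (V * (Q * Q) * Vᴴ) =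
      (U * P * P * Uᴴ * V * Q) * (Q * Vᴴ) := fun P Q => by simp only [mul_assoc]
  rw [h1, eigs_mul_comm]
  congr 1
  simp only [mul_assoc]

theorem Matrix.PosDef.exists_log_diagonalization {n : ℕ} {x₀ : EReal}
    {X : Matrix (Fin n) (Fin n) ℂ} (hX : X.PosDef) (hs : spectrum ℝ X ⊆ dom x₀) :
    ∃ (U : Matrix (Fin n) (Fin n) ℂ) (α : Fin n → ℝ), Uᴴ * U = 1 ∧ (∀ i, α i ∈ logDom x₀) ∧
      X = U * expDiag α * Uᴴ ∧
      ∀ g : ℝ → ℝ, cfc g X = U * diagonal (fun i => (g (Real.exp (α i)) : ℂ)) * Uᴴ := by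
  have hpos := hX.eigenvalues_pos
  have hmem : ∀ i, hX.1.eigenvalues i ∈ dom x₀ := fun i =>
    hs (hX.1.eigenvalues_mem_spectrum_real i)
  have hcfc : ∀ g : ℝ → ℝ, cfc g X = (hX.1.eigenvectorUnitary : Matrix (Fin n) (Fin n) ℂ) *
      diagonal (fun i => (g (Real.exp (Real.log (hX.1.eigenvalues i))) : ℂ)) *
      (hX.1.eigenvectorUnitary : Matrix (Fin n) (Fin n) ℂ)ᴴ := by
    intro g
    rw [hX.1.cfc_eq g, IsHermitian.cfc, Unitary.conjStarAlgAut_apply]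
    simp only [Real.exp_log (hpos _)]
    rfl
  refine ⟨hX.1.eigenvectorUnitary, fun i => Real.log (hX.1.eigenvalues i),
    Unitary.coe_star_mul_self hX.1.eigenvectorUnitary,
    fun i => log_mem_logDom (hmem i) (hpos i), ?_, hcfc⟩
  have h := hcfc id
  exact (cfc_id ℝ X hX.1).symm.trans h

theorem logSubmaj_of_classB {x₀ : EReal} {g : ℝ → ℝ} (hg : ClassB x₀ g) {n : ℕ}
    {X Y : Matrix (Fin n) (Fin n) ℂ} (hX : X.PosDef) (hY : Y.PosDef)
    (hXs : spectrum ℝ X ⊆ dom x₀) (hYs : spectrum ℝ Y ⊆ dom x₀) :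
    LogSubmaj ((eigs (X * Y)).map fun t => g (Real.sqrt t) ^ 2) (eigs (cfc g X * cfc g Y)) := by
  obtain ⟨U, α, hU, hα, hXU, hXg⟩ := hX.exists_log_diagonalization hXs
  obtain ⟨V, β, hV, hβ, hYV, hYg⟩ := hY.exists_log_diagonalization hYs
  refine ⟨by rw [Multiset.card_map, card_eigs, card_eigs], fun k hk1 hk => ?_⟩
  rw [Multiset.card_map, card_eigs] at hk
  have hW : (Uᴴ * V)ᴴ * (Uᴴ * V) = 1 := by
    rw [conjTranspose_mul, conjTranspose_conjTranspose, mul_assoc, ← mul_assoc U,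
      mul_eq_one_comm.1 hU, one_mul, hV]
  set W := Uᴴ * V with hWdef
  have hne : (univ : Finset (Fin n)).Nonempty := ⟨⟨0, by omega⟩, mem_univ _⟩
  obtain ⟨i₁, -, hi₁⟩ := exists_max_image univ α hne
  obtain ⟨i₂, -, hi₂⟩ := exists_max_image univ β hne
  -- Half of each entry is at most (max α + max β)/2, hence at most the larger maximum, which lies
  -- in the lower set.
  have haJ : ∀ i, logSing W α β i / 2 ∈ logDom x₀ := by
    intro i
    have h1 := logSing_le hW (α := α) (β := β) (fun j => hi₁ j (mem_univ _))
      (fun j => hi₂ j (mem_univ _)) i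
    rcases le_total (α i₁) (β i₂) with h | h
    · exact isLowerSet_logDom x₀ (by linarith) (hβ i₂)
    · exact isLowerSet_logDom x₀ (by linarith) (hα i₁)
  have hLHS : (eigs (X * Y)).map (fun t => g (Real.sqrt t) ^ 2) =
      univ.val.map fun i => g (Real.exp (logSing W α β i / 2)) ^ 2 := by
    rw [hXU, hYV, eigs_expDiag_mul, Multiset.map_map]
    refine Multiset.map_congr rfl fun i _ => ?_
    rw [Function.comp, ← exp_logSing hW, Real.exp_half]
  rw [hLHS]
  -- If g vanishes at one positive point it vanishes at all, and both sides are zero; otherwise h is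
  -- finite everywhere.
  by_cases h0 : g (Real.exp (α i₁)) = 0
  · have hz : ∀ u ∈ logDom x₀, g (Real.exp u) = 0 := fun u hu =>
      hg.exp_eq_zero_of_exp_eq_zero (hα i₁) hu h0
    have h1 : eigs (cfc g X * cfc g Y) = univ.val.map fun _ : Fin n => (0 : ℝ) := by
      refine eigs_of_similar (S := 1) (T := 1) (one_mul 1) ?_
      rw [hXg]
      simp [hz _ (hα _)]
    simp [h1, hz _ (haJ _)]
  have hpos : ∀ u ∈ logDom x₀, 0 < g (Real.exp u) := fun u hu =>
    hg.exp_pos_of_ne_zero (hα i₁) h0 hu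
  have hexp := fun x hx y hy hxy => hg.sub_le_logConj_sub hpos (x := x) (y := y) hx hy hxy
  have hmono : MonotoneOn (logConj g) (logDom x₀) := fun x hx y hy hxy => by
    linarith [hexp x hx y hy hxy]
  have hgexp : ∀ u ∈ logDom x₀, g (Real.exp u) = Real.exp (logConj g u) := fun u hu =>
    (Real.exp_log (hpos u hu)).symm
  have hRHS : eigs (cfc g X * cfc g Y) = univ.val.map
      (sqSing (expSandwich W (logConj g ∘ α) (logConj g ∘ β))) := by
    rw [hXg, hYg, hWdef, ← eigs_expDiag_mul]
    simp only [expDiag, Function.comp, hgexp _ (hα _), hgexp _ (hβ _)]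
  obtain ⟨ι, _, w, τ, c, φ, hw, hw1, hφ, hφS, hφJ⟩ := exists_concave_interpolation
    (isLowerSet_logDom x₀) (hg.convexOn_logConj hpos) hexp (univ.image α ∪ univ.image β)
    ((hne.image α).mono subset_union_left) (fun x hx => by
      simp only [mem_union, mem_image, mem_univ, true_and] at hx
      rcases hx with ⟨i, rfl⟩ | ⟨i, rfl⟩
      exacts [hα i, hβ i])
  have hφα : φ ∘ (logConj g ∘ α) = α := by
    ext i
    exact hφS _ (mem_union_left _ (mem_image_of_mem _ (mem_univ i)))
  have hφβ : φ ∘ (logConj g ∘ β) = β := by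
    ext i
    exact hφS _ (mem_union_right _ (mem_image_of_mem _ (mem_univ i)))
  have hmaj : ∀ m (hm : m ≤ n), ∑ i : Fin m, logSing W α β (Fin.castLE hm i) / 2 ≤
      ∑ i : Fin m, φ (logSing W (logConj g ∘ α) (logConj g ∘ β) (Fin.castLE hm i) / 2) := by
    intro m hm
    have h1 := sum_logSing_comp_le hW hm univ (fun j _ => hw j) hw1 hφ (logConj g ∘ α)
      (logConj g ∘ β)
    rw [hφα, hφβ, ← Finset.mul_sum] at h1
    rw [← Finset.sum_div]
    linarith
  have hanti : Antitone fun i => logSing W α β i / 2 := fun i j hij => by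
    have := logSing_antitone hW α β hij
    simp only
    linarith
  -- Only the left vector has to be sorted. The values of φ stay in the domain of h even when L(h∘α,
  -- h∘β)/2 leaves the range of h.
  have hsum := sum_le_sum_of_weakMajorization
    (b := fun i => φ (logSing W (logConj g ∘ α) (logConj g ∘ β) i / 2)) (isOpen_logDom x₀) (hg.convexOn_logConj hpos) hmono
    hanti haJ (fun i => (hφJ _).1) hmaj k hk
  have hsum2 : ∑ i : Fin k, logConj g (logSing W α β (Fin.castLE hk i) / 2) ≤
      ∑ i : Fin k, logSing W (logConj g ∘ α) (logConj g ∘ β) (Fin.castLE hk i) / 2 :=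
    hsum.trans (Finset.sum_le_sum fun i _ => (hφJ _).2)
  have hLanti : Antitone fun i => g (Real.exp (logSing W α β i / 2)) ^ 2 := fun i j hij => by
    simp only [hgexp _ (haJ _)]
    exact pow_le_pow_left₀ (Real.exp_pos _).le
      (Real.exp_le_exp.2 (hmono (haJ j) (haJ i) (hanti hij))) 2
  rw [hRHS, topProd_map hk hLanti, topProd_map hk (sqSing_antitone _)]
  simp only [hgexp _ (haJ _), ← exp_logSing hW, ← Real.exp_nat_mul, ← Real.exp_sum]
  rw [Real.exp_le_exp, ← Finset.mul_sum]
  rw [← Finset.sum_div] at hsum2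
  push_cast
  linarith

/-! ### Trace and corner-entry bounds for the largest eigenvalue. -/

theorem eigs_sum {n : ℕ} (M : Matrix (Fin n) (Fin n) ℂ) : (eigs M).sum = M.trace.re := by
  rw [trace_eq_sum_roots_charpoly, eigs]
  exact (map_multiset_sum Complex.reAddGroupHom _).symm

theorem le_topProd_one {s : Multiset ℝ} {a : ℝ} (ha : a ∈ s) : a ≤ topProd s 1 := by
  have h1 : a ∈ s.sort (fun a b => b ≤ a) := by simpa using ha
  have h2 := Multiset.pairwise_sort s (fun a b : ℝ => b ≤ a)
  rw [topProd]
  cases hl : s.sort (fun a b => b ≤ a) with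
  | nil => simp [hl] at h1
  | cons b l =>
    rw [hl] at h1 h2
    rw [List.take_succ_cons, List.take_zero, List.prod_singleton]
    rcases List.mem_cons.1 h1 with rfl | h
    · exact le_rfl
    · exact (List.pairwise_cons.1 h2).1 a h

theorem eigs_mul_of_conjTranspose_mul_self {n : ℕ} (R T : Matrix (Fin n) (Fin n) ℂ) :
    eigs (Rᴴ * R * (Tᴴ * T)) = univ.val.map (sqSing (T * Rᴴ)) := by
  rw [← eigs_conjTranspose_mul_self, mul_assoc, eigs_mul_comm, conjTranspose_mul,
    conjTranspose_conjTranspose]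
  simp only [mul_assoc]

open scoped MatrixOrder Matrix.Norms.L2Operator in
theorem Matrix.PosSemidef.exists_eq_conjTranspose_mul_self {n : ℕ} {A : Matrix (Fin n) (Fin n) ℂ}
    (hA : A.PosSemidef) : ∃ R : Matrix (Fin n) (Fin n) ℂ, A = Rᴴ * R :=
  CStarAlgebra.nonneg_iff_eq_star_mul_self.mp hA.nonneg

theorem topProd_one_eigs_mul_le {n : ℕ} (hn : 1 ≤ n) {A B : Matrix (Fin n) (Fin n) ℂ}
    (hA : A.PosSemidef) (hB : B.PosSemidef) : topProd (eigs (A * B)) 1 ≤ (A * B).trace.re := by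
  obtain ⟨R, rfl⟩ := hA.exists_eq_conjTranspose_mul_self
  obtain ⟨T, rfl⟩ := hB.exists_eq_conjTranspose_mul_self
  rw [← eigs_sum, eigs_mul_of_conjTranspose_mul_self, topProd_map hn (sqSing_antitone _),
    Fin.prod_univ_one]
  exact Finset.single_le_sum (f := sqSing (T * Rᴴ)) (fun i _ => sqSing_nonneg _ i) (mem_univ _)

theorem re_conjTranspose_mul_self_le_sqSing {n : ℕ} (hn : 1 ≤ n) (M : Matrix (Fin n) (Fin n) ℂ) :
    ((Mᴴ * M) (Fin.castLE hn 0) (Fin.castLE hn 0)).re ≤ sqSing M (Fin.castLE hn 0) := by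
  have h := gramBound_prod_sqSing M hn ((1 : Matrix (Fin n) (Fin n) ℂ).submatrix id (Fin.castLE hn))
  have h1 : M * (1 : Matrix (Fin n) (Fin n) ℂ).submatrix id (Fin.castLE hn) =
      M.submatrix id (Fin.castLE hn) := by
    ext i j
    simp [mul_apply, one_apply]
  rw [h1, conjTranspose_submatrix, conjTranspose_submatrix,
    ← submatrix_mul _ _ _ id _ Function.bijective_id,
    ← submatrix_mul _ _ _ id _ Function.bijective_id, det_fin_one, det_fin_one,
    Fin.prod_univ_one] at h
  simpa using h

/-- The witness is the largest eigenvalue. With B = T*T it is the top squared singular value of TR,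
so it dominates the diagonal entries of RBR, and the trace dominates it. -/
theorem exists_eigs_mul_mem {n : ℕ} (hn : 1 ≤ n) {R B : Matrix (Fin n) (Fin n) ℂ}
    (hR : Rᴴ = R) (hB : B.PosSemidef) : ∃ d ∈ eigs (R * R * B),
      ((R * B * R) (Fin.castLE hn 0) (Fin.castLE hn 0)).re ≤ d ∧ d ≤ (R * R * B).trace.re := by
  obtain ⟨T, rfl⟩ := hB.exists_eq_conjTranspose_mul_self
  have h1 := eigs_mul_of_conjTranspose_mul_self R T
  rw [hR] at h1
  refine ⟨sqSing (T * R) (Fin.castLE hn 0), ?_, ?_, ?_⟩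
  · rw [h1]
    exact Multiset.mem_map_of_mem _ (mem_univ_val _)
  · have h2 := re_conjTranspose_mul_self_le_sqSing hn (T * R)
    rw [conjTranspose_mul, hR] at h2
    simpa only [mul_assoc] using h2
  · rw [← eigs_sum, h1]
    exact Finset.single_le_sum (f := sqSing (T * R)) (fun i _ => sqSing_nonneg _ i) (mem_univ _)

/-! ### Functional calculus for affine functions of a projection. -/

section Projection

variable {n : ℕ} {P : Matrix (Fin n) (Fin n) ℂ} (hP : P.IsHermitian) (hPP : P * P = P)

include hP

theorem cfc_affine (a b : ℝ) : cfc (fun t => a + b * t) P = a • 1 + b • P := by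
  have hP' : IsSelfAdjoint P := hP
  rw [cfc_const_add a (fun t => b * t) P (finite_real_spectrum.continuousOn _) hP',
    cfc_const_mul_id b P hP', Algebra.algebraMap_eq_smul_one]

include hPP

theorem spectrum_affine_projection_subset (a b : ℝ) :
    spectrum ℝ (a • 1 + b • P) ⊆ {a, a + b} := by
  have hP' : IsSelfAdjoint P := hP
  rw [← cfc_affine hP, cfc_map_spectrum _ P hP' (finite_real_spectrum.continuousOn _)]
  rintro _ ⟨t, ht, rfl⟩
  rcases IsIdempotentElem.spectrum_subset ℝ hPP ht with rfl | rfl <;> simp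

theorem cfc_affine_projection (g : ℝ → ℝ) (a b : ℝ) :
    cfc g (a • 1 + b • P) = g a • 1 + (g (a + b) - g a) • P := by
  have hP' : IsSelfAdjoint P := hP
  rw [← cfc_affine hP, ← cfc_affine hP, ← cfc_comp' g _ P
    (((finite_real_spectrum (A := P)).image _).continuousOn g) (finite_real_spectrum.continuousOn _) hP']
  refine cfc_congr fun t ht => ?_
  rcases IsIdempotentElem.spectrum_subset ℝ hPP ht with rfl | rfl <;> simp

theorem posDef_affine_projection {a b : ℝ} (ha : 0 < a) (hb : 0 ≤ b) :
    (a • (1 : Matrix (Fin n) (Fin n) ℂ) + b • P).PosDef := by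
  have h1 : P.PosSemidef := by
    have := posSemidef_conjTranspose_mul_self P
    rwa [hP.eq, hPP] at this
  exact (PosDef.one.smul ha).add_posSemidef (h1.smul hb)

theorem posSemidef_affine_projection {a b : ℝ} (ha : 0 ≤ a) (hb : 0 ≤ a + b) :
    (a • (1 : Matrix (Fin n) (Fin n) ℂ) + b • P).PosSemidef := by
  have h1 : P.PosSemidef := by
    have := posSemidef_conjTranspose_mul_self P
    rwa [hP.eq, hPP] at this
  have h2 : (1 - P).PosSemidef := by
    have := posSemidef_conjTranspose_mul_self (1 - P)
    rw [conjTranspose_sub, conjTranspose_one, hP.eq, sub_mul, mul_sub, mul_sub, hPP] at this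
    simpa using this
  have h3 : a • (1 : Matrix (Fin n) (Fin n) ℂ) + b • P = a • (1 - P) + (a + b) • P := by module
  rw [h3]
  exact (h2.smul ha).add (h1.smul hb)

end Projection

/-! ### From log-submajorisation to class B. -/

section Converse

variable {x₀ : EReal} {g : ℝ → ℝ}

theorem geomConvexOn_of_logSubmaj (h0 : g 0 = 0)
    (H : ∀ (n : ℕ) (X Y : Matrix (Fin n) (Fin n) ℂ), X.PosDef → Y.PosDef →
        spectrum ℝ X ⊆ dom x₀ → spectrum ℝ Y ⊆ dom x₀ →
        LogSubmaj ((eigs (X * Y)).map fun t => g (Real.sqrt t) ^ 2) (eigs (cfc g X * cfc g Y))) :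
    GeomConvexOn (dom x₀) g := by
  intro x hx y hy
  rcases hx.1.eq_or_lt with rfl | hx0
  · simp [h0]
  rcases hy.1.eq_or_lt with rfl | hy0
  · simp [h0]
  have hP : (0 : Matrix (Fin 1) (Fin 1) ℂ).IsHermitian := isHermitian_zero
  have hPP : (0 : Matrix (Fin 1) (Fin 1) ℂ) * 0 = 0 := mul_zero 0
  have hs : ∀ a ∈ dom x₀, spectrum ℝ (a • (1 : Matrix (Fin 1) (Fin 1) ℂ) + (0 : ℝ) • 0) ⊆ dom x₀ :=
    fun a ha => (spectrum_affine_projection_subset hP hPP a 0).trans (by simpa [Set.pair_subset_iff])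
  have h1 := (H 1 _ _ (posDef_affine_projection hP hPP hx0 le_rfl)
    (posDef_affine_projection hP hPP hy0 le_rfl) (hs x hx) (hs y hy)).2 1 le_rfl
    (by rw [Multiset.card_map, card_eigs])
  rw [cfc_affine_projection hP hPP, cfc_affine_projection hP hPP] at h1
  have he : ∀ a b : ℝ, eigs ((a • (1 : Matrix (Fin 1) (Fin 1) ℂ)) * (b • 1)) = {a * b} := by
    intro a b
    rw [eigs_of_similar (S := 1) (T := 1) (d := fun _ => a * b) (one_mul 1)]
    · simp
    · ext i j
      fin_cases i
      fin_cases j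
      simp [mul_comm]
  simp only [smul_zero, add_zero, he, Multiset.map_singleton] at h1
  simp only [topProd, Multiset.sort_singleton, List.take_succ_cons, List.take_zero,
    List.prod_singleton] at h1
  exact Real.le_sqrt_of_sq_le h1

/-- X and Y are ε + (x - ε)P and ε + (x - ε)Q for rank-one projections P, Q with tr PQ = c². Trace
bounds on both sides differ from the rank-one values (xc)² and (c g(x))² by terms that vanish with ε
and g(ε). Positive ε keeps X and Y positive definite. -/
theorem exists_near_eigenvalue (hnonneg : ∀ x ∈ dom x₀, 0 ≤ g x)
    (H : ∀ (n : ℕ) (X Y : Matrix (Fin n) (Fin n) ℂ), X.PosDef → Y.PosDef →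
        spectrum ℝ X ⊆ dom x₀ → spectrum ℝ Y ⊆ dom x₀ →
        LogSubmaj ((eigs (X * Y)).map fun t => g (Real.sqrt t) ^ 2) (eigs (cfc g X * cfc g Y)))
    {x c ε : ℝ} (hx : x ∈ dom x₀) (hc0 : 0 ≤ c) (hc1 : c ≤ 1) (hε : 0 < ε) (hεx : ε ≤ x) :
    ∃ d, (x * c) ^ 2 ≤ d ∧ d ≤ (x * c) ^ 2 + (ε ^ 2 * c ^ 2 + 2 * ε * x * (1 - c ^ 2)) ∧
      g (Real.sqrt d) ^ 2 ≤
        (c * g x) ^ 2 + (g ε ^ 2 * c ^ 2 + 2 * g ε * g x * (1 - c ^ 2)) := by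
  have hεm : ε ∈ dom x₀ := ⟨hε.le, lt_of_le_of_lt (EReal.coe_le_coe_iff.2 hεx) hx.2⟩
  let s : ℝ := Real.sqrt (1 - c ^ 2)
  have hs : s * s = 1 - c * c := by
    rw [Real.mul_self_sqrt (by nlinarith)]
    ring
  have hsC : (s : ℂ) * s = 1 - c * c := by exact_mod_cast hs
  let P : Matrix (Fin 2) (Fin 2) ℂ := !![1, 0; 0, 0]
  let Q : Matrix (Fin 2) (Fin 2) ℂ := !![(c : ℂ) * c, c * s; c * s, s * s]
  have hP : P.IsHermitian := by
    ext i j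
    fin_cases i <;> fin_cases j <;> simp [P]
  have hQ : Q.IsHermitian := by
    ext i j
    fin_cases i <;> fin_cases j <;> simp [Q]
  have hPP : P * P = P := by
    ext i j
    fin_cases i <;> fin_cases j <;> simp [P]
  have hQQ : Q * Q = Q := by
    ext i j
    fin_cases i <;> fin_cases j <;> simp [Q, mul_apply, Fin.sum_univ_two]
    · linear_combination (c * c : ℂ) * hsC
    · linear_combination (c * s : ℂ) * hsC
    · linear_combination (c * s : ℂ) * hsC
    · linear_combination (s * s : ℂ) * hsC
  have hb : 0 ≤ x - ε := sub_nonneg.2 hεx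
  have hspec : ({ε, ε + (x - ε)} : Set ℝ) ⊆ dom x₀ := by
    rw [add_sub_cancel]
    exact Set.pair_subset_iff.2 ⟨hεm, hx⟩
  have hX := posDef_affine_projection hP hPP hε hb
  have hY := posDef_affine_projection hQ hQQ hε hb
  have h1 := (H 2 _ _ hX hY ((spectrum_affine_projection_subset hP hPP _ _).trans hspec)
    ((spectrum_affine_projection_subset hQ hQQ _ _).trans hspec)).2 1 le_rfl
    (by rw [Multiset.card_map, card_eigs]; norm_num)
  have htr : ∀ a b : ℝ, ((a • 1 + b • P) * (a • 1 + b • Q)).trace.re =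
      2 * a ^ 2 + 2 * a * b + b ^ 2 * c ^ 2 := by
    intro a b
    have : ((a • 1 + b • P) * (a • 1 + b • Q)).trace =
        ((2 * a ^ 2 + 2 * a * b + b ^ 2 * c ^ 2 : ℝ) : ℂ) := by
      simp [trace_fin_two, P, Q, mul_apply, Fin.sum_univ_two]
      linear_combination (a * b : ℂ) * hsC
    rw [this, Complex.ofReal_re]
  have hR : ∀ a b : ℝ, (a • 1 + b • P)ᴴ = a • 1 + b • P := by
    intro a b
    rw [conjTranspose_add, conjTranspose_smul, conjTranspose_smul, hP.eq, conjTranspose_one]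
    simp
  have hRR : (Real.sqrt ε • 1 + (Real.sqrt x - Real.sqrt ε) • P) *
      (Real.sqrt ε • 1 + (Real.sqrt x - Real.sqrt ε) • P) = ε • 1 + (x - ε) • P := by
    have e1 : (Real.sqrt ε : ℂ) * Real.sqrt ε = ε := by
      exact_mod_cast Real.mul_self_sqrt hε.le
    have e2 : (Real.sqrt x : ℂ) * Real.sqrt x = x := by
      exact_mod_cast Real.mul_self_sqrt hx.1
    ext i j
    fin_cases i <;> fin_cases j <;> simp [P, mul_apply, Fin.sum_univ_two, e1, e2]
  -- Here R is the square root of X; the corner entry of RYR exceeds (xc)² by xε(1 - c²).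
  obtain ⟨d, hd, hd1, hd2⟩ := exists_eigs_mul_mem (n := 2) (by norm_num)
    (hR (Real.sqrt ε) (Real.sqrt x - Real.sqrt ε)) hY.posSemidef
  rw [hRR] at hd hd2
  rw [htr] at hd2
  refine ⟨d, ?_, by linarith, ?_⟩
  · refine le_trans ?_ hd1
    have e2 : (Real.sqrt x : ℂ) * Real.sqrt x = x := by
      exact_mod_cast Real.mul_self_sqrt hx.1
    have e3 : ((Real.sqrt ε • 1 + (Real.sqrt x - Real.sqrt ε) • P) * (ε • 1 + (x - ε) • Q) *
        (Real.sqrt ε • 1 + (Real.sqrt x - Real.sqrt ε) • P)) 0 0 =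
        ((x * (ε + (x - ε) * (c * c)) : ℝ) : ℂ) := by
      simp [P, Q, mul_apply, Fin.sum_univ_two]
      linear_combination (ε + (x - ε) * (c * c) : ℂ) * e2
    have e4 : (Fin.castLE (by norm_num : 1 ≤ 2) 0 : Fin 2) = 0 := rfl
    rw [e4, e3, Complex.ofReal_re]
    nlinarith [mul_nonneg (mul_nonneg hx.1 hε.le) (by nlinarith : 0 ≤ 1 - c * c)]
  · have hA : ∀ {Z : Matrix (Fin 2) (Fin 2) ℂ}, Z.IsHermitian → Z * Z = Z →
        (g ε • 1 + (g (ε + (x - ε)) - g ε) • Z).PosSemidef := fun hZ hZZ =>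
      posSemidef_affine_projection hZ hZZ (hnonneg ε hεm)
        (by rw [add_sub_cancel, add_sub_cancel]; exact hnonneg x hx)
    rw [cfc_affine_projection hP hPP, cfc_affine_projection hQ hQQ] at h1
    have h2 := h1.trans (topProd_one_eigs_mul_le (by norm_num) (hA hP hPP) (hA hQ hQQ))
    have h3 := (le_topProd_one (Multiset.mem_map_of_mem (fun t => g (Real.sqrt t) ^ 2) hd)).trans h2
    rw [htr, add_sub_cancel] at h3
    linarith

/-- Let ε → 0 in `exists_near_eigenvalue`: the errors vanish because g is continuous at 0 with g 0 =
0. -/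
theorem map_mul_le_of_logSubmaj (hx₀ : 0 < x₀) (hcont : ContinuousOn g (dom x₀))
    (hnonneg : ∀ x ∈ dom x₀, 0 ≤ g x) (h0 : g 0 = 0)
    (H : ∀ (n : ℕ) (X Y : Matrix (Fin n) (Fin n) ℂ), X.PosDef → Y.PosDef →
        spectrum ℝ X ⊆ dom x₀ → spectrum ℝ Y ⊆ dom x₀ →
        LogSubmaj ((eigs (X * Y)).map fun t => g (Real.sqrt t) ^ 2) (eigs (cfc g X * cfc g Y)))
    {x c : ℝ} (hx : x ∈ dom x₀) (hx0 : 0 < x) (hc0 : 0 < c) (hc1 : c < 1) :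
    g (x * c) ≤ c * g x := by
  let ε : ℕ → ℝ := fun m => x * (1 / 2) ^ m
  have hε0 : ∀ m, 0 < ε m := fun m => by positivity
  have hεx : ∀ m, ε m ≤ x := fun m =>
    mul_le_of_le_one_right hx0.le (pow_le_one₀ (by norm_num) (by norm_num))
  choose d hd1 hd2 hd3 using fun m =>
    exists_near_eigenvalue hnonneg H hx hc0.le hc1.le (hε0 m) (hεx m)
  have hε : Filter.Tendsto ε Filter.atTop (nhds 0) := by
    have := (tendsto_pow_atTop_nhds_zero_of_lt_one (r := (1 / 2 : ℝ)) (by norm_num)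
      (by norm_num)).const_mul x
    rwa [mul_zero] at this
  have hd : Filter.Tendsto d Filter.atTop (nhds ((x * c) ^ 2)) := by
    refine tendsto_of_tendsto_of_tendsto_of_le_of_le tendsto_const_nhds ?_ hd1 hd2
    have := (((hε.pow 2).mul_const (c ^ 2)).add
      (((hε.const_mul 2).mul_const x).mul_const (1 - c ^ 2))).const_add ((x * c) ^ 2)
    simpa using this
  have hxc : 0 < x * c := mul_pos hx0 hc0
  have hsq : Filter.Tendsto (fun m => Real.sqrt (d m)) Filter.atTop (nhds (x * c)) := by
    have := hd.sqrt
    rwa [Real.sqrt_sq hxc.le] at this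
  have hmem : dom x₀ ∈ nhds (x * c) := by
    refine Filter.mem_of_superset (Ioo_mem_nhds hxc (mul_lt_of_lt_one_right hx0 hc1)) ?_
    exact fun y hy => ⟨hy.1.le, lt_of_le_of_lt (EReal.coe_le_coe_iff.2 hy.2.le) hx.2⟩
  have hl := ((hcont.continuousAt hmem).tendsto.comp hsq).pow 2
  have hgε : Filter.Tendsto (fun m => g (ε m)) Filter.atTop (nhds 0) := by
    have h1 := (hcont 0 ⟨le_rfl, by exact_mod_cast hx₀⟩).tendsto
    rw [h0] at h1
    exact h1.comp (tendsto_nhdsWithin_iff.2 ⟨hε, Filter.Eventually.of_forall fun m =>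
      ⟨(hε0 m).le, lt_of_le_of_lt (EReal.coe_le_coe_iff.2 (hεx m)) hx.2⟩⟩)
  have hr : Filter.Tendsto (fun m => (c * g x) ^ 2 +
      (g (ε m) ^ 2 * c ^ 2 + 2 * g (ε m) * g x * (1 - c ^ 2))) Filter.atTop
      (nhds ((c * g x) ^ 2)) := by
    have := (((hgε.pow 2).mul_const (c ^ 2)).add
      (((hgε.const_mul 2).mul_const (g x)).mul_const (1 - c ^ 2))).const_add ((c * g x) ^ 2)
    simpa using this
  have h2 := le_of_tendsto_of_tendsto' hl hr hd3
  exact le_of_sq_le_sq h2 (mul_nonneg hc0.le (hnonneg x hx))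

theorem classB_of_logSubmaj (hx₀ : 0 < x₀) (hcont : ContinuousOn g (dom x₀))
    (hnonneg : ∀ x ∈ dom x₀, 0 ≤ g x) (h0 : g 0 = 0)
    (H : ∀ (n : ℕ) (X Y : Matrix (Fin n) (Fin n) ℂ), X.PosDef → Y.PosDef →
        spectrum ℝ X ⊆ dom x₀ → spectrum ℝ Y ⊆ dom x₀ →
        LogSubmaj ((eigs (X * Y)).map fun t => g (Real.sqrt t) ^ 2) (eigs (cfc g X * cfc g Y))) :
    ClassB x₀ g := by
  refine ⟨hcont, hnonneg, geomConvexOn_of_logSubmaj h0 H, fun x hx d hd => ?_⟩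
  rcases hx.1.eq_or_lt with rfl | hx0
  · simp [h0]
  have hsub : Set.Ioo 0 x ⊆ dom x₀ := fun y hy =>
    ⟨hy.1.le, lt_of_le_of_lt (EReal.coe_le_coe_iff.2 hy.2.le) hx.2⟩
  have h1 := (hasDerivWithinAt_iff_tendsto_slope' (by simp)).1 (hd.mono hsub)
  rw [nhdsWithin_Ioo_eq_nhdsLT hx0] at h1
  -- With c = t/x, g(t) ≤ (t/x) g(x) says that the chord slope from t to x is at least g(x)/x; the
  -- derivative is the limit of such slopes from the left.
  have h2 : g x / x ≤ d := by
    refine ge_of_tendsto h1 ?_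
    filter_upwards [Ioo_mem_nhdsLT hx0] with t ht
    have h3 := map_mul_le_of_logSubmaj hx₀ hcont hnonneg h0 H hx hx0 (c := t / x)
      (div_pos ht.1 hx0) ((div_lt_one hx0).2 ht.2)
    rw [mul_div_cancel₀ _ hx0.ne'] at h3
    rw [slope_comm, slope_def_field, div_le_div_iff₀ hx0 (sub_pos.2 ht.2)]
    have h4 : t / x * g x * x = t * g x := by field_simp
    nlinarith [mul_le_mul_of_nonneg_right h3 hx0.le]
  rw [div_le_iff₀ hx0] at h2
  linarith

end Converse

theorem mainTheorem2 (x₀ : EReal) (hx₀ : 0 < x₀) (g : ℝ → ℝ)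
    (hcont : ContinuousOn g (dom x₀)) (hnonneg : ∀ x ∈ dom x₀, 0 ≤ g x) :
    (g 0 = 0 ∧
      ∀ (n : ℕ) (X Y : Matrix (Fin n) (Fin n) ℂ), X.PosDef → Y.PosDef →
        spectrum ℝ X ⊆ dom x₀ → spectrum ℝ Y ⊆ dom x₀ →
        LogSubmaj ((eigs (X * Y)).map fun t => g (Real.sqrt t) ^ 2) (eigs (cfc g X * cfc g Y)))
      ↔ ClassB x₀ g :=
  ⟨fun ⟨h0, H⟩ => classB_of_logSubmaj hx₀ hcont hnonneg h0 H, fun hg =>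
    ⟨hg.map_zero hx₀, fun _ _ _ hX hY hXs hYs => logSubmaj_of_classB hg hX hY hXs hYs⟩⟩
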